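/- Let $d \ge 1$ and let $X_t$ be a non-constant isotropic unimodal Lévy process in $\mathbb{R}^d$ with $X_0 = 0$, that is, a Lévy process without drift, with Gaussian coefficient $\sigma^2 \ge 0$ and with Lévy measure $\nu(|z|)\,dz$, where $\nu : (0,\infty) \to [0,\infty)$ is non-increasing. Let $\Psi(|z|)$ be its characteristic exponent, $\mathbb{E}\, e^{i z \cdot X_t} = e^{-t \Psi(|z|)}$, where $\sigma^2$ is normalised so that $\Psi(|z|) = \sigma^2 |z|^2 + \int_{\mathbb{R}^d} (1 - \cos (z \cdot y))\, \nu(|y|)\, dy$. For $r > 0$ let $$K(r) = \frac{\sigma^2 d}{r^2} + \int_{B(0,r)} \frac{|z|^2}{r^2}\, \nu(|z|)\, dz, \qquad L(r) = \int_{\mathbb{R}^d \setminus B(0,r)} \nu(|z|)\, dz .$$ For a function $\varphi$ that is positive near infinity, the lower index of $\varphi$ at infinity is the supremum of those $a \in \mathbb{R}$ for which there are $A, R > 0$ with $\varphi(r_2)/\varphi(r_1) \ge A (r_2/r_1)^a$ whenever $R < r_1 < r_2$, and the upper index at infinity is the infimum of those $b \in \mathbb{R}$ for which there are $B, R > 0$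 with $\varphi(r_2)/\varphi(r_1) \le B (r_2/r_1)^b$ whenever $R < r_1 < r_2$. The indices at zero of a function that is positive near zero are defined in the same way, with $0 < r_1 < r_2 < R$ instead. A function which is not positive near infinity (near zero) has no index there. Two functions $f, g$ are comparable on a set if $C^{-1} g \le f \le C g$ there for some constant $C > 0$. Then: (a) For every $\beta \in [0,2)$, $\Psi$ has upper index $\beta$ at zero if and only if $L$ has lower index $-\beta$ at infinity. In this case $L(r)$, $K(r)+L(r)$ and $\Psi(1/r)$ are comparable for $r > 1$. (b) For every $\alpha \in (0,2]$, $\Psi$ has lower index $\alpha$ at zero if and only if $K$ has upper index $-\alpha$ at infinity. In this case $K(r)$, $K(r)+L(r)$ and $\Psi(1/r)$ are comparable for $r > 1$. (c) For every $\beta \in [0,2)$, $\Psi$ has upper index $\beta$ at infinity if and only if $\sigma^2 = 0$ and $L$ has lower index $-\beta$ at zero. In this case $L(R) > 0$ for some $R > 0$, and for every $R > 0$ with $L(R) > 0$ the functions $L(r)$, $K(r)+L(r)$ and $\Psi(1/r)$ are comparable for $0 < r < R$. (d) For every $\alpha \in (0,2]$, $\Psi$ has lower index $\alpha$ at infinity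 if and only if $K$ has upper index $-\alpha$ at zero. In this case $K(r)$, $K(r)+L(r)$ and $\Psi(1/r)$ are comparable for $0 < r < 1$. -/

import Mathlib

open MeasureTheory ProbabilityTheory Filter Topology Set
open scoped NNReal ENNReal

noncomputable section

namespace UnimodalLevy

/-! ### Matuszewska indices and comparability -/

/-- `φ` (positive near infinity) has lower Matuszewska index `α` at infinity: `α` is the supremum
of the exponents `a` for which `A (r₂ / r₁) ^ a ≤ φ r₂ / φ r₁` for all `r₂ > r₁ > R`, with some
constants `A, R > 0`. (In `ℝ`, `IsLUB` also says that the supremum is finite.) -/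
def HasLowerIndexAtInfinity (φ : ℝ → ℝ) (α : ℝ) : Prop :=
  (∃ R : ℝ, 0 < R ∧ ∀ r : ℝ, R < r → 0 < φ r) ∧
  IsLUB {a : ℝ | ∃ A R : ℝ, 0 < A ∧ 0 < R ∧
    ∀ r₁ r₂ : ℝ, R < r₁ → r₁ < r₂ → A * (r₂ / r₁) ^ a ≤ φ r₂ / φ r₁} α

/-- `φ` (positive near infinity) has upper Matuszewska index `β` at infinity. -/
def HasUpperIndexAtInfinity (φ : ℝ → ℝ) (β : ℝ) : Prop :=
  (∃ R : ℝ, 0 < R ∧ ∀ r : ℝ, R < r → 0 < φ r) ∧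
  IsGLB {b : ℝ | ∃ B R : ℝ, 0 < B ∧ 0 < R ∧
    ∀ r₁ r₂ : ℝ, R < r₁ → r₁ < r₂ → φ r₂ / φ r₁ ≤ B * (r₂ / r₁) ^ b} β

/-- `φ` (positive on some `(0, R)`) has lower Matuszewska index `α` at zero. -/
def HasLowerIndexAtZero (φ : ℝ → ℝ) (α : ℝ) : Prop :=
  (∃ R : ℝ, 0 < R ∧ ∀ r : ℝ, 0 < r → r < R → 0 < φ r) ∧
  IsLUB {a : ℝ | ∃ A R : ℝ, 0 < A ∧ 0 < R ∧
    ∀ r₁ r₂ : ℝ, 0 < r₁ → r₁ < r₂ → r₂ < R → A * (r₂ / r₁) ^ a ≤ φ r₂ / φ r₁} α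

/-- `φ` (positive on some `(0, R)`) has upper Matuszewska index `β` at zero. -/
def HasUpperIndexAtZero (φ : ℝ → ℝ) (β : ℝ) : Prop :=
  (∃ R : ℝ, 0 < R ∧ ∀ r : ℝ, 0 < r → r < R → 0 < φ r) ∧
  IsGLB {b : ℝ | ∃ B R : ℝ, 0 < B ∧ 0 < R ∧
    ∀ r₁ r₂ : ℝ, 0 < r₁ → r₁ < r₂ → r₂ < R → φ r₂ / φ r₁ ≤ B * (r₂ / r₁) ^ b} β

/-- `C⁻¹ g ≤ f ≤ C g` on `s`, with some constant `C > 0`. -/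
def ComparableOn (s : Set ℝ) (f g : ℝ → ℝ) : Prop :=
  ∃ C : ℝ, 0 < C ∧ ∀ r ∈ s, C⁻¹ * g r ≤ f r ∧ f r ≤ C * g r

/-! ### Lévy processes -/

section LevyProc

variable {d : ℕ} {Ω : Type*} [MeasurableSpace Ω]

/-- A Lévy process in `ℝᵈ`, started at the origin: independent and stationary increments,
càdlàg paths. -/
structure IsLevyProcess (X : ℝ≥0 → Ω → EuclideanSpace ℝ (Fin d)) (P : Measure Ω) : Prop where
  measurable : ∀ t, Measurable (X t)
  zero : ∀ᵐ ω ∂P, X 0 ω = 0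
  indep : HasIndepIncrements X P
  stationary : ∀ s t : ℝ≥0, P.map (fun ω => X (s + t) ω - X s ω) = P.map (fun ω => X t ω - X 0 ω)
  cadlag : ∀ᵐ ω ∂P, ∀ t : ℝ≥0, ContinuousWithinAt (fun s => X s ω) (Ici t) t ∧
    ∃ l : EuclideanSpace ℝ (Fin d), Tendsto (fun s => X s ω) (𝓝[<] t) (𝓝 l)

/-- A Lévy measure on `ℝᵈ`. -/
def IsLevyMeasure (N : Measure (EuclideanSpace ℝ (Fin d))) : Prop :=
  N {0} = 0 ∧ ∫⁻ y, ENNReal.ofReal (min 1 (‖y‖ ^ 2)) ∂N < ∞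

/-- The Lévy–Khintchine exponent with drift `b`, Gaussian part `A` and Lévy measure `N`. The
Gaussian part is normalised so that it contributes `⟨z, A z⟩` (without the factor `1 / 2`). -/
def levyKhintchineExponent (b : EuclideanSpace ℝ (Fin d))
    (A : EuclideanSpace ℝ (Fin d) →L[ℝ] EuclideanSpace ℝ (Fin d))
    (N : Measure (EuclideanSpace ℝ (Fin d))) (z : EuclideanSpace ℝ (Fin d)) : ℂ :=
  -(Complex.I * (inner ℝ b z : ℝ)) + (inner ℝ z (A z) : ℝ) +
    ∫ y, (1 - Complex.exp (Complex.I * (inner ℝ y z : ℝ)) +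
      (Metric.ball (0 : EuclideanSpace ℝ (Fin d)) 1).indicator
        (fun y => Complex.I * (inner ℝ y z : ℝ)) y) ∂N

/-- `(b, A, N)` is the generating triplet of the process `X`. -/
def HasLevyTriplet (X : ℝ≥0 → Ω → EuclideanSpace ℝ (Fin d)) (P : Measure Ω)
    (b : EuclideanSpace ℝ (Fin d))
    (A : EuclideanSpace ℝ (Fin d) →L[ℝ] EuclideanSpace ℝ (Fin d))
    (N : Measure (EuclideanSpace ℝ (Fin d))) : Prop :=
  A.IsPositive ∧ IsLevyMeasure N ∧
    ∀ (t : ℝ≥0) (z : EuclideanSpace ℝ (Fin d)),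
      charFun (P.map (X t)) z = Complex.exp (-((t : ℝ) : ℂ) * levyKhintchineExponent b A N z)

/-- `X` is a non-constant isotropic unimodal Lévy process in `ℝᵈ` with Gaussian coefficient `σ²`,
whose Lévy measure has density `ν(|z|)`, with non-increasing radial profile `ν` on `(0, ∞)`. -/
structure IsIsotropicUnimodalLevyProcess (X : ℝ≥0 → Ω → EuclideanSpace ℝ (Fin d)) (P : Measure Ω)
    (σ : ℝ) (ν : ℝ → ℝ) : Prop where
  isLevy : IsLevyProcess X P
  nonconstant : ¬ ∀ t : ℝ≥0, ∀ᵐ ω ∂P, X t ω = X 0 ω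
  profile_nonneg : ∀ r : ℝ, 0 < r → 0 ≤ ν r
  profile_antitone : AntitoneOn ν (Ioi 0)
  triplet : HasLevyTriplet X P 0 (σ ^ 2 • ContinuousLinearMap.id ℝ (EuclideanSpace ℝ (Fin d)))
    (volume.withDensity fun z : EuclideanSpace ℝ (Fin d) => ENNReal.ofReal (ν ‖z‖))

/-- `Ψ(|z|)` is the characteristic exponent of `X`: `E exp(i z · X_t) = exp(-t Ψ(|z|))`. -/
def IsCharExponentProfile (X : ℝ≥0 → Ω → EuclideanSpace ℝ (Fin d)) (P : Measure Ω)
    (Ψ : ℝ → ℝ) : Prop :=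
  ∀ (t : ℝ≥0) (z : EuclideanSpace ℝ (Fin d)),
    charFun (P.map (X t)) z = Complex.exp (((-((t : ℝ) * Ψ ‖z‖) : ℝ) : ℂ))

end LevyProc

/-! ### Pruitt's functions -/

/-- `K(r) = σ² d / r² + ∫_{B(0,r)} (|z|² / r²) ν(|z|) dz`. -/
def pruittK (d : ℕ) (σ : ℝ) (ν : ℝ → ℝ) (r : ℝ) : ℝ :=
  σ ^ 2 * d / r ^ 2 +
    ∫ z in Metric.ball (0 : EuclideanSpace ℝ (Fin d)) r, ‖z‖ ^ 2 / r ^ 2 * ν ‖z‖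

/-- `L(r) = ∫_{ℝᵈ ∖ B(0,r)} ν(|z|) dz`. -/
def pruittL (d : ℕ) (ν : ℝ → ℝ) (r : ℝ) : ℝ :=
  ∫ z in (Metric.ball (0 : EuclideanSpace ℝ (Fin d)) r)ᶜ, ν ‖z‖

end UnimodalLevy

end

/-! Write `h = K + L`. Two facts carry the proof.

First, `Ψ(1/r)` is comparable with `h(r)` for all `r > 0` (`comparableOn_charExponent`). The upper
bound uses `1 - cos x ≤ x²/2` for jumps inside the ball of radius `r` and `1 - cos x ≤ 2` outside.
For the lower bound, sum the exponent over the `d` coordinate directions, which all give the same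
value by isotropy. Then `1 - cos x ≥ 2x²/π²` on `|x| ≤ π` recovers the truncated second moment. The
tail is recovered from unimodality (`radialMeasure_halfSpace_le`): far points where the cosine is
near 1 are translated by half a period towards the origin, where `1 - cos ≥ 1` and the density is no
smaller. Hence the indices of `Ψ` at zero and infinity are, up to sign, those of `h` at infinity and
zero.

Second, `d(r² K(r)) = -r² dL(r)`. `IsPruittPair` keeps only the two inequalities this gives between
two radii, with signs, monotonicity and limits. They yield `l² h(lr) - h(r) ≤ (l² - 1) L(r)` and
`h(r) - h(lr) ≤ (l² - 1) K(lr)`. If `h` has a lower exponent above `-2`, a large `l` makes the first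
left side at least `h(r)`, so `L` dominates; if `h` has a negative upper exponent, the second makes
`K` dominate. Conversely, a power bound for `L` or `K` alone is iterated along a geometric sequence
of radii: the sum is controlled by one end term, up to a boundary term. For `L` near zero the
boundary term is the limit `σ² d` of `r² K(r)`, whence the condition on `σ` in (c). -/

namespace UnimodalLevy

/-! ### Power bounds on a set and Matuszewska indices -/

/-- `φ` satisfies a lower power bound with exponent `a` on `s`. -/
def LowerPowerBound (s : Set ℝ) (φ : ℝ → ℝ) (a : ℝ) : Prop :=
  ∃ A : ℝ, 0 < A ∧ ∀ r₁ ∈ s, ∀ r₂ ∈ s, r₁ < r₂ → A * (r₂ / r₁) ^ a ≤ φ r₂ / φ r₁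

/-- `φ` satisfies an upper power bound with exponent `b` on `s`. -/
def UpperPowerBound (s : Set ℝ) (φ : ℝ → ℝ) (b : ℝ) : Prop :=
  ∃ B : ℝ, 0 < B ∧ ∀ r₁ ∈ s, ∀ r₂ ∈ s, r₁ < r₂ → φ r₂ / φ r₁ ≤ B * (r₂ / r₁) ^ b

lemma hasLowerIndexAtInfinity_iff {φ : ℝ → ℝ} {α : ℝ} :
    HasLowerIndexAtInfinity φ α ↔ (∃ R : ℝ, 0 < R ∧ ∀ r ∈ Ioi R, 0 < φ r) ∧
      IsLUB {a | ∃ R : ℝ, 0 < R ∧ LowerPowerBound (Ioi R) φ a} α := by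
  have : {a : ℝ | ∃ A R : ℝ, 0 < A ∧ 0 < R ∧
      ∀ r₁ r₂ : ℝ, R < r₁ → r₁ < r₂ → A * (r₂ / r₁) ^ a ≤ φ r₂ / φ r₁} =
      {a | ∃ R : ℝ, 0 < R ∧ LowerPowerBound (Ioi R) φ a} := by
    ext a
    constructor
    · rintro ⟨A, R, hA, hR, h⟩
      exact ⟨R, hR, A, hA, fun r₁ h₁ r₂ _ h₁₂ => h r₁ r₂ h₁ h₁₂⟩
    · rintro ⟨R, hR, A, hA, h⟩
      exact ⟨A, R, hA, hR, fun r₁ r₂ h₁ h₁₂ => h r₁ h₁ r₂ (lt_trans h₁ h₁₂) h₁₂⟩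
  rw [HasLowerIndexAtInfinity, this]
  rfl

lemma hasUpperIndexAtInfinity_iff {φ : ℝ → ℝ} {β : ℝ} :
    HasUpperIndexAtInfinity φ β ↔ (∃ R : ℝ, 0 < R ∧ ∀ r ∈ Ioi R, 0 < φ r) ∧
      IsGLB {b | ∃ R : ℝ, 0 < R ∧ UpperPowerBound (Ioi R) φ b} β := by
  have : {b : ℝ | ∃ B R : ℝ, 0 < B ∧ 0 < R ∧
      ∀ r₁ r₂ : ℝ, R < r₁ → r₁ < r₂ → φ r₂ / φ r₁ ≤ B * (r₂ / r₁) ^ b} =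
      {b | ∃ R : ℝ, 0 < R ∧ UpperPowerBound (Ioi R) φ b} := by
    ext a
    constructor
    · rintro ⟨A, R, hA, hR, h⟩
      exact ⟨R, hR, A, hA, fun r₁ h₁ r₂ _ h₁₂ => h r₁ r₂ h₁ h₁₂⟩
    · rintro ⟨R, hR, A, hA, h⟩
      exact ⟨A, R, hA, hR, fun r₁ r₂ h₁ h₁₂ => h r₁ h₁ r₂ (lt_trans h₁ h₁₂) h₁₂⟩
  rw [HasUpperIndexAtInfinity, this]
  rfl

lemma hasLowerIndexAtZero_iff {φ : ℝ → ℝ} {α : ℝ} :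
    HasLowerIndexAtZero φ α ↔ (∃ R : ℝ, 0 < R ∧ ∀ r ∈ Ioo 0 R, 0 < φ r) ∧
      IsLUB {a | ∃ R : ℝ, 0 < R ∧ LowerPowerBound (Ioo 0 R) φ a} α := by
  have : {a : ℝ | ∃ A R : ℝ, 0 < A ∧ 0 < R ∧
      ∀ r₁ r₂ : ℝ, 0 < r₁ → r₁ < r₂ → r₂ < R → A * (r₂ / r₁) ^ a ≤ φ r₂ / φ r₁} =
      {a | ∃ R : ℝ, 0 < R ∧ LowerPowerBound (Ioo 0 R) φ a} := by
    ext a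
    constructor
    · rintro ⟨A, R, hA, hR, h⟩
      exact ⟨R, hR, A, hA, fun r₁ h₁ r₂ h₂ h₁₂ => h r₁ r₂ h₁.1 h₁₂ h₂.2⟩
    · rintro ⟨R, hR, A, hA, h⟩
      exact ⟨A, R, hA, hR, fun r₁ r₂ h₁ h₁₂ h₂ =>
        h r₁ ⟨h₁, h₁₂.trans h₂⟩ r₂ ⟨h₁.trans h₁₂, h₂⟩ h₁₂⟩
  rw [HasLowerIndexAtZero, this]
  simp only [mem_Ioo, and_imp]

lemma hasUpperIndexAtZero_iff {φ : ℝ → ℝ} {β : ℝ} :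
    HasUpperIndexAtZero φ β ↔ (∃ R : ℝ, 0 < R ∧ ∀ r ∈ Ioo 0 R, 0 < φ r) ∧
      IsGLB {b | ∃ R : ℝ, 0 < R ∧ UpperPowerBound (Ioo 0 R) φ b} β := by
  have : {b : ℝ | ∃ B R : ℝ, 0 < B ∧ 0 < R ∧
      ∀ r₁ r₂ : ℝ, 0 < r₁ → r₁ < r₂ → r₂ < R → φ r₂ / φ r₁ ≤ B * (r₂ / r₁) ^ b} =
      {b | ∃ R : ℝ, 0 < R ∧ UpperPowerBound (Ioo 0 R) φ b} := by
    ext a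
    constructor
    · rintro ⟨A, R, hA, hR, h⟩
      exact ⟨R, hR, A, hA, fun r₁ h₁ r₂ h₂ h₁₂ => h r₁ r₂ h₁.1 h₁₂ h₂.2⟩
    · rintro ⟨R, hR, A, hA, h⟩
      exact ⟨A, R, hA, hR, fun r₁ r₂ h₁ h₁₂ h₂ =>
        h r₁ ⟨h₁, h₁₂.trans h₂⟩ r₂ ⟨h₁.trans h₁₂, h₂⟩ h₁₂⟩
  rw [HasUpperIndexAtZero, this]
  simp only [mem_Ioo, and_imp]

lemma LowerPowerBound.mono {s t : Set ℝ} {φ : ℝ → ℝ} {a : ℝ} (h : LowerPowerBound t φ a)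
    (hst : s ⊆ t) : LowerPowerBound s φ a := by
  obtain ⟨A, hA, h⟩ := h
  exact ⟨A, hA, fun r₁ h₁ r₂ h₂ => h r₁ (hst h₁) r₂ (hst h₂)⟩

lemma UpperPowerBound.mono {s t : Set ℝ} {φ : ℝ → ℝ} {a : ℝ} (h : UpperPowerBound t φ a)
    (hst : s ⊆ t) : UpperPowerBound s φ a := by
  obtain ⟨A, hA, h⟩ := h
  exact ⟨A, hA, fun r₁ h₁ r₂ h₂ => h r₁ (hst h₁) r₂ (hst h₂)⟩

/-! ### Invariance of power bounds and indices under comparability. -/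

lemma ComparableOn.mono {s t : Set ℝ} {f g : ℝ → ℝ} (h : ComparableOn t f g) (hst : s ⊆ t) :
    ComparableOn s f g := by
  obtain ⟨C, hC, h⟩ := h
  exact ⟨C, hC, fun r hr => h r (hst hr)⟩

lemma ComparableOn.symm {s : Set ℝ} {f g : ℝ → ℝ} (h : ComparableOn s f g) :
    ComparableOn s g f := by
  obtain ⟨C, hC, h⟩ := h
  refine ⟨C, hC, fun r hr => ⟨?_, ?_⟩⟩
  · rw [inv_mul_le_iff₀ hC]; exact (h r hr).2
  · rw [← inv_mul_le_iff₀ hC]; exact (h r hr).1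

lemma ComparableOn.pos {s : Set ℝ} {f g : ℝ → ℝ} (h : ComparableOn s f g)
    (hf : ∀ r ∈ s, 0 < f r) : ∀ r ∈ s, 0 < g r := by
  obtain ⟨C, hC, h⟩ := h
  intro r hr
  exact pos_of_mul_pos_right ((hf r hr).trans_le (h r hr).2) hC.le

lemma div_le_sq_mul_div {C x₁ x₂ y₁ y₂ : ℝ} (hC : 0 < C) (hx₁ : 0 < x₁) (hy₁ : 0 < y₁)
    (hy₂ : 0 < y₂) (h₂ : x₂ ≤ C * y₂) (h₁ : C⁻¹ * y₁ ≤ x₁) :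
    x₂ / x₁ ≤ C ^ 2 * (y₂ / y₁) := by
  rw [div_le_iff₀ hx₁]
  calc x₂ ≤ C * y₂ := h₂
    _ = C ^ 2 * (y₂ / y₁) * (C⁻¹ * y₁) := by field_simp
    _ ≤ _ := by gcongr

lemma LowerPowerBound.of_comparableOn {s : Set ℝ} {f g : ℝ → ℝ} {a : ℝ}
    (h : LowerPowerBound s f a) (hfg : ComparableOn s f g) (hf : ∀ r ∈ s, 0 < f r) :
    LowerPowerBound s g a := by
  have hg := hfg.pos hf
  obtain ⟨A, hA, h⟩ := h
  obtain ⟨C, hC, hfg⟩ := hfg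
  refine ⟨(C ^ 2)⁻¹ * A, by positivity, fun r₁ h₁ r₂ h₂ h₁₂ => ?_⟩
  rw [mul_assoc, inv_mul_le_iff₀ (by positivity)]
  exact (h r₁ h₁ r₂ h₂ h₁₂).trans
    (div_le_sq_mul_div hC (hf _ h₁) (hg _ h₁) (hg _ h₂) (hfg _ h₂).2 (hfg _ h₁).1)

lemma UpperPowerBound.of_comparableOn {s : Set ℝ} {f g : ℝ → ℝ} {a : ℝ}
    (h : UpperPowerBound s f a) (hfg : ComparableOn s f g) (hf : ∀ r ∈ s, 0 < f r) :
    UpperPowerBound s g a := by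
  have hg := hfg.pos hf
  obtain ⟨A, hA, h⟩ := h
  obtain ⟨C, hC, hfg⟩ := hfg.symm
  refine ⟨C ^ 2 * A, by positivity, fun r₁ h₁ r₂ h₂ h₁₂ => ?_⟩
  rw [mul_assoc]
  exact (div_le_sq_mul_div hC (hg _ h₁) (hf _ h₁) (hf _ h₂) (hfg _ h₂).2 (hfg _ h₁).1).trans
    (mul_le_mul_of_nonneg_left (h r₁ h₁ r₂ h₂ h₁₂) (by positivity))

/-- Comparability changes only the constant in a power bound, so `f` and `g` have the same set of
admissible exponents. The threshold is first raised so that both functions are positive. -/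
lemma HasLowerIndexAtInfinity.of_comparableOn {f g : ℝ → ℝ} {α R : ℝ}
    (h : HasLowerIndexAtInfinity f α) (hfg : ComparableOn (Ioi R) f g) :
    HasLowerIndexAtInfinity g α := by
  rw [hasLowerIndexAtInfinity_iff] at h ⊢
  obtain ⟨⟨R₀, hR₀, hpos⟩, hlub⟩ := h
  have hsub : Ioi (max R R₀) ⊆ Ioi R := Ioi_subset_Ioi (le_max_left _ _)
  have hf : ∀ r ∈ Ioi (max R R₀), 0 < f r := fun r hr =>
    hpos r (Ioi_subset_Ioi (le_max_right _ _) hr)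
  have hg := (hfg.mono hsub).pos hf
  have hR : 0 < max R R₀ := hR₀.trans_le (le_max_right _ _)
  refine ⟨⟨_, hR, hg⟩, ?_⟩
  convert hlub using 1
  ext a
  constructor
  · rintro ⟨S, hS, h⟩
    have h1 : Ioi (max S (max R R₀)) ⊆ Ioi (max R R₀) := Ioi_subset_Ioi (le_max_right _ _)
    exact ⟨_, hS.trans_le (le_max_left _ _),
      (h.mono (Ioi_subset_Ioi (le_max_left _ _))).of_comparableOn
      (hfg.symm.mono (h1.trans hsub)) fun r hr => hg r (h1 hr)⟩
  · rintro ⟨S, hS, h⟩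
    have h1 : Ioi (max S (max R R₀)) ⊆ Ioi (max R R₀) := Ioi_subset_Ioi (le_max_right _ _)
    exact ⟨_, hS.trans_le (le_max_left _ _),
      (h.mono (Ioi_subset_Ioi (le_max_left _ _))).of_comparableOn
      (hfg.mono (h1.trans hsub)) fun r hr => hf r (h1 hr)⟩

lemma HasUpperIndexAtInfinity.of_comparableOn {f g : ℝ → ℝ} {β R : ℝ}
    (h : HasUpperIndexAtInfinity f β) (hfg : ComparableOn (Ioi R) f g) :
    HasUpperIndexAtInfinity g β := by
  rw [hasUpperIndexAtInfinity_iff] at h ⊢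
  obtain ⟨⟨R₀, hR₀, hpos⟩, hlub⟩ := h
  have hsub : Ioi (max R R₀) ⊆ Ioi R := Ioi_subset_Ioi (le_max_left _ _)
  have hf : ∀ r ∈ Ioi (max R R₀), 0 < f r := fun r hr =>
    hpos r (Ioi_subset_Ioi (le_max_right _ _) hr)
  have hg := (hfg.mono hsub).pos hf
  have hR : 0 < max R R₀ := hR₀.trans_le (le_max_right _ _)
  refine ⟨⟨_, hR, hg⟩, ?_⟩
  convert hlub using 1
  ext a
  constructor
  · rintro ⟨S, hS, h⟩
    have h1 : Ioi (max S (max R R₀)) ⊆ Ioi (max R R₀) := Ioi_subset_Ioi (le_max_right _ _)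
    exact ⟨_, hS.trans_le (le_max_left _ _),
      (h.mono (Ioi_subset_Ioi (le_max_left _ _))).of_comparableOn
      (hfg.symm.mono (h1.trans hsub)) fun r hr => hg r (h1 hr)⟩
  · rintro ⟨S, hS, h⟩
    have h1 : Ioi (max S (max R R₀)) ⊆ Ioi (max R R₀) := Ioi_subset_Ioi (le_max_right _ _)
    exact ⟨_, hS.trans_le (le_max_left _ _),
      (h.mono (Ioi_subset_Ioi (le_max_left _ _))).of_comparableOn
      (hfg.mono (h1.trans hsub)) fun r hr => hf r (h1 hr)⟩

/-! ### Passing between zero and infinity by `r ↦ 1 / r`. -/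

lemma comparableOn_comp_inv_Ioi {f g : ℝ → ℝ} {R : ℝ} (hR : 0 < R)
    (h : ComparableOn (Ioo 0 R) f g) :
    ComparableOn (Ioi R⁻¹) (fun r => f (1 / r)) (fun r => g (1 / r)) := by
  obtain ⟨C, hC, h⟩ := h
  refine ⟨C, hC, fun r hr => h _ ?_⟩
  have hr0 : 0 < r := (inv_pos.2 hR).trans hr
  exact ⟨by positivity, by rw [one_div]; exact inv_lt_of_inv_lt₀ hR hr⟩

/-- Inversion swaps the two radii but keeps `r₂ / r₁`, and turns the quotient of values upside down.
Taking reciprocals exchanges lower with upper bounds, `a` with `-a` and `A` with `A⁻¹`. -/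
lemma lowerPowerBound_Ioo_iff {φ : ℝ → ℝ} {a R : ℝ} (hR : 0 < R)
    (hpos : ∀ r ∈ Ioo 0 R, 0 < φ r) :
    LowerPowerBound (Ioo 0 R) φ a ↔ UpperPowerBound (Ioi R⁻¹) (fun r => φ (1 / r)) (-a) := by
  have key : ∀ A r₁ r₂ : ℝ, 0 < A → 0 < r₁ → r₁ < r₂ → r₂ < R →
      (A * (r₂ / r₁) ^ a ≤ φ r₂ / φ r₁ ↔ φ r₁ / φ r₂ ≤ A⁻¹ * (r₁⁻¹ / r₂⁻¹) ^ (-a)) := by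
    intro A r₁ r₂ hA h₁ h₁₂ h₂
    have hr₂ : 0 < r₂ := h₁.trans h₁₂
    have e : r₁⁻¹ / r₂⁻¹ = r₂ / r₁ := by field_simp
    have p₁ := hpos r₁ ⟨h₁, h₁₂.trans h₂⟩
    have p₂ := hpos r₂ ⟨hr₂, h₂⟩
    rw [e, Real.rpow_neg (by positivity), ← mul_inv, ← inv_div (φ r₂), inv_le_inv₀]
    · positivity
    · positivity
  constructor
  · rintro ⟨A, hA, h⟩
    refine ⟨A⁻¹, by positivity, fun r₁ h₁ r₂ h₂ h₁₂ => ?_⟩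
    have q₁ : 0 < r₁ := (inv_pos.2 hR).trans h₁
    have q₂ : 0 < r₂ := (inv_pos.2 hR).trans h₂
    have m₁ : r₁⁻¹ < R := inv_lt_of_inv_lt₀ hR h₁
    have m₂ : r₂⁻¹ < R := inv_lt_of_inv_lt₀ hR h₂
    have m₁₂ : r₂⁻¹ < r₁⁻¹ := (inv_lt_inv₀ q₂ q₁).2 h₁₂
    have := (key A _ _ hA (by positivity) m₁₂ m₁).1
      (h _ ⟨by positivity, m₂⟩ _ ⟨by positivity, m₁⟩ m₁₂)
    simpa using this
  · rintro ⟨B, hB, h⟩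
    refine ⟨B⁻¹, by positivity, fun r₁ h₁ r₂ h₂ h₁₂ => ?_⟩
    rw [key _ _ _ (by positivity) h₁.1 h₁₂ h₂.2]
    have := h r₂⁻¹ ((inv_lt_inv₀ hR h₂.1).2 h₂.2) r₁⁻¹ ((inv_lt_inv₀ hR h₁.1).2 h₁.2)
      ((inv_lt_inv₀ h₂.1 h₁.1).2 h₁₂)
    simpa using this

lemma upperPowerBound_Ioo_iff {φ : ℝ → ℝ} {a R : ℝ} (hR : 0 < R)
    (hpos : ∀ r ∈ Ioo 0 R, 0 < φ r) :
    UpperPowerBound (Ioo 0 R) φ a ↔ LowerPowerBound (Ioi R⁻¹) (fun r => φ (1 / r)) (-a) := by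
  have key : ∀ A r₁ r₂ : ℝ, 0 < A → 0 < r₁ → r₁ < r₂ → r₂ < R →
      (φ r₂ / φ r₁ ≤ A * (r₂ / r₁) ^ a ↔ A⁻¹ * (r₁⁻¹ / r₂⁻¹) ^ (-a) ≤ φ r₁ / φ r₂) := by
    intro A r₁ r₂ hA h₁ h₁₂ h₂
    have hr₂ : 0 < r₂ := h₁.trans h₁₂
    have e : r₁⁻¹ / r₂⁻¹ = r₂ / r₁ := by field_simp
    have p₁ := hpos r₁ ⟨h₁, h₁₂.trans h₂⟩
    have p₂ := hpos r₂ ⟨hr₂, h₂⟩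
    rw [e, Real.rpow_neg (by positivity), ← mul_inv, ← inv_div (φ r₂), inv_le_inv₀]
    · positivity
    · positivity
  constructor
  · rintro ⟨A, hA, h⟩
    refine ⟨A⁻¹, by positivity, fun r₁ h₁ r₂ h₂ h₁₂ => ?_⟩
    have q₁ : 0 < r₁ := (inv_pos.2 hR).trans h₁
    have q₂ : 0 < r₂ := (inv_pos.2 hR).trans h₂
    have m₁ : r₁⁻¹ < R := inv_lt_of_inv_lt₀ hR h₁
    have m₂ : r₂⁻¹ < R := inv_lt_of_inv_lt₀ hR h₂
    have m₁₂ : r₂⁻¹ < r₁⁻¹ := (inv_lt_inv₀ q₂ q₁).2 h₁₂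
    have := (key A _ _ hA (by positivity) m₁₂ m₁).1
      (h _ ⟨by positivity, m₂⟩ _ ⟨by positivity, m₁⟩ m₁₂)
    simpa using this
  · rintro ⟨B, hB, h⟩
    refine ⟨B⁻¹, by positivity, fun r₁ h₁ r₂ h₂ h₁₂ => ?_⟩
    rw [key _ _ _ (by positivity) h₁.1 h₁₂ h₂.2]
    have := h r₂⁻¹ ((inv_lt_inv₀ hR h₂.1).2 h₂.2) r₁⁻¹ ((inv_lt_inv₀ hR h₁.1).2 h₁.2)
      ((inv_lt_inv₀ h₂.1 h₁.1).2 h₁₂)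
    simpa using this

lemma eventually_pos_comp_inv_iff {φ : ℝ → ℝ} :
    (∃ R : ℝ, 0 < R ∧ ∀ r ∈ Ioo 0 R, 0 < φ r) ↔
      ∃ R : ℝ, 0 < R ∧ ∀ r ∈ Ioi R, 0 < φ (1 / r) := by
  constructor
  · rintro ⟨R, hR, h⟩
    refine ⟨R⁻¹, by positivity, fun r hr => h _ ?_⟩
    have hr0 : 0 < r := (inv_pos.2 hR).trans hr
    exact ⟨by positivity, by rw [one_div]; exact inv_lt_of_inv_lt₀ hR hr⟩
  · rintro ⟨R, hR, h⟩
    refine ⟨R⁻¹, by positivity, fun r hr => ?_⟩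
    simpa using h r⁻¹ (by
      have := (inv_lt_inv₀ (inv_pos.2 hR) hr.1).2 hr.2
      simpa using this)

/-- The two bounds are known to correspond only on intervals where the function is positive. Since
both survive shrinking the set, the threshold may be cut down to that range. -/
lemma exists_powerBound_comp_inv_iff {p q : Set ℝ → Prop} {R₀ : ℝ} (hR₀ : 0 < R₀)
    (hp : ∀ s t, s ⊆ t → p t → p s) (hq : ∀ s t, s ⊆ t → q t → q s)
    (h : ∀ R, 0 < R → R ≤ R₀ → (p (Ioo 0 R) ↔ q (Ioi R⁻¹))) :
    (∃ R, 0 < R ∧ p (Ioo 0 R)) ↔ ∃ R, 0 < R ∧ q (Ioi R) := by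
  constructor
  · rintro ⟨R, hR, hpR⟩
    have hm : 0 < min R R₀ := lt_min hR hR₀
    exact ⟨_, inv_pos.2 hm, (h _ hm (min_le_right _ _)).1
      (hp _ _ (Ioo_subset_Ioo_right (min_le_left _ _)) hpR)⟩
  · rintro ⟨R, hR, hqR⟩
    have hm : 0 < min R⁻¹ R₀ := lt_min (inv_pos.2 hR) hR₀
    refine ⟨_, hm, (h _ hm (min_le_right _ _)).2 (hq _ _ (Ioi_subset_Ioi ?_) hqR)⟩
    exact (le_inv_comm₀ hm hR).1 (min_le_left _ _)

lemma hasUpperIndexAtZero_iff_comp_inv {φ : ℝ → ℝ} {β : ℝ} :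
    HasUpperIndexAtZero φ β ↔ HasLowerIndexAtInfinity (fun r => φ (1 / r)) (-β) := by
  rw [hasUpperIndexAtZero_iff, hasLowerIndexAtInfinity_iff, ← eventually_pos_comp_inv_iff]
  refine and_congr_right fun ⟨R₀, hR₀, hpos⟩ => ?_
  rw [← isGLB_neg]
  apply iff_of_eq
  congr 1
  ext b
  rw [Set.mem_neg]
  exact exists_powerBound_comp_inv_iff (p := fun s => UpperPowerBound s φ b)
    (q := fun s => LowerPowerBound s (fun r => φ (1 / r)) (-b)) hR₀
    (fun s t h h' => h'.mono h) (fun s t h h' => h'.mono h)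
    fun R hR hR' => upperPowerBound_Ioo_iff hR fun r hr => hpos r ⟨hr.1, hr.2.trans_le hR'⟩

lemma hasLowerIndexAtZero_iff_comp_inv {φ : ℝ → ℝ} {α : ℝ} :
    HasLowerIndexAtZero φ α ↔ HasUpperIndexAtInfinity (fun r => φ (1 / r)) (-α) := by
  rw [hasLowerIndexAtZero_iff, hasUpperIndexAtInfinity_iff, ← eventually_pos_comp_inv_iff]
  refine and_congr_right fun ⟨R₀, hR₀, hpos⟩ => ?_
  rw [← isLUB_neg]
  apply iff_of_eq
  congr 1
  ext b
  rw [Set.mem_neg]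
  exact exists_powerBound_comp_inv_iff (p := fun s => LowerPowerBound s φ b)
    (q := fun s => UpperPowerBound s (fun r => φ (1 / r)) (-b)) hR₀
    (fun s t h h' => h'.mono h) (fun s t h h' => h'.mono h)
    fun R hR hR' => lowerPowerBound_Ioo_iff hR fun r hr => hpos r ⟨hr.1, hr.2.trans_le hR'⟩

lemma hasUpperIndexAtInfinity_iff_comp_inv {φ : ℝ → ℝ} {β : ℝ} :
    HasUpperIndexAtInfinity φ β ↔ HasLowerIndexAtZero (fun r => φ (1 / r)) (-β) := by
  rw [hasLowerIndexAtZero_iff_comp_inv, neg_neg]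
  simp only [one_div_one_div]

lemma hasLowerIndexAtInfinity_iff_comp_inv {φ : ℝ → ℝ} {α : ℝ} :
    HasLowerIndexAtInfinity φ α ↔ HasUpperIndexAtZero (fun r => φ (1 / r)) (-α) := by
  rw [hasUpperIndexAtZero_iff_comp_inv, neg_neg]
  simp only [one_div_one_div]

lemma HasLowerIndexAtZero.of_comparableOn {f g : ℝ → ℝ} {α R : ℝ} (hR : 0 < R)
    (h : HasLowerIndexAtZero f α) (hfg : ComparableOn (Ioo 0 R) f g) :
    HasLowerIndexAtZero g α := by
  rw [hasLowerIndexAtZero_iff_comp_inv] at h ⊢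
  exact h.of_comparableOn (comparableOn_comp_inv_Ioi hR hfg)

lemma HasUpperIndexAtZero.of_comparableOn {f g : ℝ → ℝ} {β R : ℝ} (hR : 0 < R)
    (h : HasUpperIndexAtZero f β) (hfg : ComparableOn (Ioo 0 R) f g) :
    HasUpperIndexAtZero g β := by
  rw [hasUpperIndexAtZero_iff_comp_inv] at h ⊢
  exact h.of_comparableOn (comparableOn_comp_inv_Ioi hR hfg)

/-! ### Pairs of functions with the scaling properties of `K` and `L` -/

/-- The properties of Pruitt's functions `K` and `L` that determine the relations between the
indices of `K`, `L` and `K + L`. -/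
structure IsPruittPair (K L : ℝ → ℝ) (c : ℝ) : Prop where
  K_pos : ∀ r, 0 < r → 0 < K r
  L_nonneg : ∀ r, 0 < r → 0 ≤ L r
  L_antitone : ∀ r s, 0 < r → r ≤ s → L s ≤ L r
  lower : ∀ r s, 0 < r → r ≤ s → r ^ 2 * (L r - L s) ≤ s ^ 2 * K s - r ^ 2 * K r
  upper : ∀ r s, 0 < r → r ≤ s → s ^ 2 * K s - r ^ 2 * K r ≤ s ^ 2 * (L r - L s)
  tendsto_L : Tendsto L atTop (𝓝 0)
  tendsto_K : Tendsto (fun r => r ^ 2 * K r) (𝓝[>] 0) (𝓝 c)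

/-- Supplies the scale ratio for all doubling arguments: one step by `l` gains a factor 2, which
beats the constant in the power bound. -/
lemma exists_scale {A p : ℝ} (hA : 0 < A) (hp : 0 < p) : ∃ l : ℝ, 1 < l ∧ 2 ≤ A * l ^ p := by
  have h := (tendsto_rpow_atTop hp).const_mul_atTop hA
  obtain ⟨l, h1, h2⟩ := ((eventually_gt_atTop 1).and (h.eventually_ge_atTop 2)).exists
  exact ⟨l, h1, h2⟩

lemma exists_pow_scale {l r s : ℝ} (hl : 1 < l) (hr : 0 < r) (hrs : r ≤ s) :
    ∃ n : ℕ, l ^ n * r ≤ s ∧ s < l ^ (n + 1) * r := by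
  obtain ⟨n, h1, h2⟩ := exists_nat_pow_near ((one_le_div hr).2 hrs) hl
  exact ⟨n, (le_div_iff₀ hr).1 h1, (div_lt_iff₀ hr).1 h2⟩

namespace IsPruittPair

variable {K L : ℝ → ℝ} {c : ℝ}

/-! ### Monotonicity and one-step inequalities. -/

lemma sq_mul_K_mono (h : IsPruittPair K L c) {r s : ℝ} (hr : 0 < r) (hrs : r ≤ s) :
    r ^ 2 * K r ≤ s ^ 2 * K s := by
  have h1 := h.lower r s hr hrs
  have h2 := h.L_antitone r s hr hrs
  have : 0 ≤ r ^ 2 * (L r - L s) := mul_nonneg (sq_nonneg _) (sub_nonneg.2 h2)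
  linarith

lemma add_pos (h : IsPruittPair K L c) {r : ℝ} (hr : 0 < r) : 0 < K r + L r :=
  add_pos_of_pos_of_nonneg (h.K_pos r hr) (h.L_nonneg r hr)

lemma add_antitone (h : IsPruittPair K L c) {r s : ℝ} (hr : 0 < r) (hrs : r ≤ s) :
    K s + L s ≤ K r + L r := by
  have h1 := h.upper r s hr hrs
  have hs : 0 < s := hr.trans_le hrs
  have h2 : r ^ 2 * K r ≤ s ^ 2 * K r := by
    have := (h.K_pos r hr).le
    gcongr
  have h3 : s ^ 2 * (K s + L s) ≤ s ^ 2 * (K r + L r) := by linarith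
  exact le_of_mul_le_mul_left h3 (by positivity)

/-- This is `upper` between `r` and `l * r`, with the terms in `L (l * r)` cancelling. It limits the
growth of `r² (K + L)` by `L` alone. -/
lemma sq_mul_add_le (h : IsPruittPair K L c) {l r : ℝ} (hl : 1 ≤ l) (hr : 0 < r) :
    l ^ 2 * (K (l * r) + L (l * r)) - (K r + L r) ≤ (l ^ 2 - 1) * L r := by
  have h1 := h.upper r (l * r) hr (le_mul_of_one_le_left hr.le hl)
  have h3 : r ^ 2 * (l ^ 2 * (K (l * r) + L (l * r)) - (K r + L r)) ≤
      r ^ 2 * ((l ^ 2 - 1) * L r) := by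
    linarith
  exact le_of_mul_le_mul_left h3 (by positivity)

/-- This is `lower` between `r` and `l * r`, with the terms in `K r` and `L r` regrouped. It limits
the decrease of `K + L` by `K` alone. -/
lemma add_sub_le (h : IsPruittPair K L c) {l r : ℝ} (hl : 1 ≤ l) (hr : 0 < r) :
    (K r + L r) - (K (l * r) + L (l * r)) ≤ (l ^ 2 - 1) * K (l * r) := by
  have h1 := h.lower r (l * r) hr (le_mul_of_one_le_left hr.le hl)
  have h3 : r ^ 2 * ((K r + L r) - (K (l * r) + L (l * r))) ≤
      r ^ 2 * ((l ^ 2 - 1) * K (l * r)) := by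
    linarith
  exact le_of_mul_le_mul_left h3 (by positivity)

/-- A lower power bound for `K + L` with exponent above `-2` makes `L` dominate. -/
lemma add_le_L (h : IsPruittPair K L c) {s : Set ℝ} {a : ℝ} (hs : s ⊆ Ioi 0) (ha : -2 < a)
    (hb : LowerPowerBound s (fun r => K r + L r) a) :
    ∃ l C : ℝ, 1 < l ∧ 0 < C ∧ ∀ r ∈ s, l * r ∈ s → K r + L r ≤ C * L r := by
  obtain ⟨A, hA, hb⟩ := hb
  obtain ⟨l, hl, hl2⟩ := exists_scale (p := a + 2) hA (by linarith)
  have hl0 : 0 < l := by linarith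
  refine ⟨l, l ^ 2 - 1, hl, by nlinarith, fun r hr hlr => ?_⟩
  have hr0 : 0 < r := hs hr
  have h1 := hb r hr _ hlr (lt_mul_of_one_lt_left hr0 hl)
  rw [mul_div_cancel_right₀ _ hr0.ne', le_div_iff₀ (h.add_pos hr0)] at h1
  have h2 := h.sq_mul_add_le hl.le hr0
  have h3 : l ^ (a + 2) = l ^ a * l ^ 2 := by
    rw [Real.rpow_add hl0]; norm_num
  -- By the choice of `l`, the left side of `sq_mul_add_le` is at least `K r + L r`.
  have h4 : 2 * (K r + L r) ≤ l ^ 2 * (K (l * r) + L (l * r)) :=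
    calc 2 * (K r + L r) ≤ A * l ^ (a + 2) * (K r + L r) :=
          mul_le_mul_of_nonneg_right hl2 (h.add_pos hr0).le
      _ = l ^ 2 * (A * l ^ a * (K r + L r)) := by rw [h3]; ring
      _ ≤ _ := mul_le_mul_of_nonneg_left h1 (by positivity)
  linarith

/-- Iterated comparison of `r² K r` at two scales under a lower power bound for `L`. -/
lemma sq_mul_K_le (h : IsPruittPair K L c) {s : Set ℝ} [hoc : OrdConnected s] {a : ℝ}
    (hs : s ⊆ Ioi 0) (ha : -2 < a) (hL : ∀ r ∈ s, 0 < L r) (hb : LowerPowerBound s L a) :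
    ∃ l C : ℝ, 1 < l ∧ 0 < C ∧ ∀ (n : ℕ) (r : ℝ), r ∈ s → l ^ n * r ∈ s →
      (l ^ n * r) ^ 2 * K (l ^ n * r) ≤ r ^ 2 * K r + C * ((l ^ n * r) ^ 2 * L (l ^ n * r)) := by
  obtain ⟨A, hA, hb⟩ := hb
  obtain ⟨l, hl, hl2⟩ := exists_scale (p := a + 2) hA (by linarith)
  have hl0 : 0 < l := by linarith
  -- The constant `l ^ 2` reproduces itself: the old error and the new increment are each at most
  -- `l² t² L t`, and `2 * L t ≤ l² * L (l * t)` absorbs their sum.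
  refine ⟨l, l ^ 2, hl, by positivity, fun n => ?_⟩
  induction n with
  | zero =>
    intro r hr _
    have := hL r hr
    simp only [pow_zero, one_mul]
    have : 0 ≤ l ^ 2 * (r ^ 2 * L r) := by positivity
    linarith
  | succ n ih =>
    intro r hr hnr
    have hr0 : 0 < r := hs hr
    set t := l ^ n * r with ht
    have e : l ^ (n + 1) * r = l * t := by rw [ht]; ring
    rw [e] at hnr ⊢
    have hn1 : 1 ≤ l ^ n := one_le_pow₀ hl.le
    have ht0 : 0 < t := by positivity
    have hts : t ∈ s := hoc.out hr hnr
      ⟨le_mul_of_one_le_left hr0.le hn1, le_mul_of_one_le_left ht0.le hl.le⟩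
    have h1 := ih r hr hts
    have h2 := h.upper t (l * t) ht0 (le_mul_of_one_le_left ht0.le hl.le)
    have h3 := hb t hts _ hnr (lt_mul_of_one_lt_left ht0 hl)
    have hLt := hL t hts
    have hLlt := hL _ hnr
    rw [mul_div_cancel_right₀ _ ht0.ne', le_div_iff₀ hLt] at h3
    have h3' : l ^ (a + 2) = l ^ a * l ^ 2 := by
      rw [Real.rpow_add hl0]; norm_num
    have h4 : 2 * L t ≤ l ^ 2 * L (l * t) :=
      calc 2 * L t ≤ A * l ^ (a + 2) * L t := mul_le_mul_of_nonneg_right hl2 hLt.le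
        _ = l ^ 2 * (A * l ^ a * L t) := by rw [h3']; ring
        _ ≤ _ := mul_le_mul_of_nonneg_left h3 (by positivity)
    have h5 : l ^ 2 * t ^ 2 * (2 * L t) ≤ l ^ 2 * t ^ 2 * (l ^ 2 * L (l * t)) :=
      mul_le_mul_of_nonneg_left h4 (by positivity)
    have h6 : 0 ≤ (l * t) ^ 2 * L (l * t) := by positivity
    nlinarith

/-- An upper power bound for `K + L` with negative exponent makes `K` dominate. -/
lemma add_le_K (h : IsPruittPair K L c) {s : Set ℝ} {b : ℝ} (hs : s ⊆ Ioi 0) (hb0 : b < 0)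
    (hb : UpperPowerBound s (fun r => K r + L r) b) :
    ∃ l C : ℝ, 1 < l ∧ 0 < C ∧ ∀ r ∈ s, l * r ∈ s →
      K (l * r) + L (l * r) ≤ C * K (l * r) := by
  obtain ⟨B, hB, hb⟩ := hb
  obtain ⟨l, hl, hl2⟩ := exists_scale (p := -b) (inv_pos.2 hB) (by linarith)
  have hl0 : 0 < l := by linarith
  refine ⟨l, l ^ 2 - 1, hl, by nlinarith, fun r hr hlr => ?_⟩
  have hr0 : 0 < r := hs hr
  have h1 := hb r hr _ hlr (lt_mul_of_one_lt_left hr0 hl)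
  rw [mul_div_cancel_right₀ _ hr0.ne', div_le_iff₀ (h.add_pos hr0)] at h1
  have h2 := h.add_sub_le hl.le hr0
  have h3 : 2 * (B * l ^ b) ≤ 1 := by
    rw [Real.rpow_neg hl0.le, ← mul_inv] at hl2
    rwa [← le_div_iff₀ (by positivity), one_div]
  have h4 := mul_le_mul_of_nonneg_right h3 (h.add_pos hr0).le
  linarith

/-- Iterated comparison of `L` at two scales under an upper power bound for `K`. -/
lemma L_le_add (h : IsPruittPair K L c) {s : Set ℝ} [hoc : OrdConnected s] {b : ℝ}
    (hs : s ⊆ Ioi 0) (hb0 : b < 0) (hb : UpperPowerBound s K b) :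
    ∃ l C : ℝ, 1 < l ∧ 0 < C ∧ ∀ (n : ℕ) (r : ℝ), r ∈ s → l ^ n * r ∈ s →
      L r ≤ L (l ^ n * r) + C * K r := by
  obtain ⟨B, hB, hb⟩ := hb
  obtain ⟨l, hl, hl2⟩ := exists_scale (p := -b) (inv_pos.2 hB) (by linarith)
  have hl0 : 0 < l := by linarith
  have h3 : 2 * (B * l ^ b) ≤ 1 := by
    rw [Real.rpow_neg hl0.le, ← mul_inv] at hl2
    rwa [← le_div_iff₀ (by positivity), one_div]
  refine ⟨l, l ^ 2, hl, by positivity, fun n => ?_⟩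
  induction n with
  | zero =>
    intro r hr _
    have := h.K_pos r (hs hr)
    simp only [pow_zero, one_mul]
    have : 0 ≤ l ^ 2 * K r := by positivity
    linarith
  | succ n ih =>
    intro r hr hnr
    have hr0 : 0 < r := hs hr
    -- The first step is peeled off, not the last, since the error is measured at the smaller end
    -- `r`; `2 * K (l * r) ≤ K r` then keeps the constant `l ^ 2`.
    have e : l ^ (n + 1) * r = l ^ n * (l * r) := by ring
    rw [e] at hnr ⊢
    have hn1 : 1 ≤ l ^ n := one_le_pow₀ hl.le
    have ht0 : 0 < l * r := by positivity
    have hts : l * r ∈ s := hoc.out hr hnr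
      ⟨le_mul_of_one_le_left hr0.le hl.le, le_mul_of_one_le_left ht0.le hn1⟩
    have h1 := ih _ hts hnr
    have h2 := h.add_sub_le hl.le hr0
    have hK := h.K_pos r hr0
    have h4 := hb r hr _ hts (lt_mul_of_one_lt_left hr0 hl)
    rw [mul_div_cancel_right₀ _ hr0.ne', div_le_iff₀ hK] at h4
    have h5 := mul_le_mul_of_nonneg_right h3 hK.le
    have h6 : l ^ 2 * (2 * K (l * r)) ≤ l ^ 2 * K r :=
      mul_le_mul_of_nonneg_left (by linarith) (by positivity)
    linarith

/-! #### Domination near infinity -/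

lemma add_le_L_Ioi (h : IsPruittPair K L c) {a R : ℝ} (hR : 0 < R) (ha : -2 < a)
    (hb : LowerPowerBound (Ioi R) (fun r => K r + L r) a) :
    ∃ C : ℝ, 0 < C ∧ ∀ r ∈ Ioi R, K r + L r ≤ C * L r := by
  obtain ⟨l, C, hl, hC, h1⟩ := h.add_le_L (fun r hr => hR.trans hr) ha hb
  exact ⟨C, hC, fun r hr => h1 r hr (hr.trans (lt_mul_of_one_lt_left (hR.trans hr) hl))⟩

lemma add_le_K_Ioi (h : IsPruittPair K L c) {b R : ℝ} (hR : 0 < R) (hb0 : b < 0)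
    (hb : UpperPowerBound (Ioi R) (fun r => K r + L r) b) :
    ∃ R' C : ℝ, 0 < R' ∧ 0 < C ∧ ∀ r ∈ Ioi R', K r + L r ≤ C * K r := by
  obtain ⟨l, C, hl, hC, h1⟩ := h.add_le_K (fun r hr => hR.trans hr) hb0 hb
  have hl0 : 0 < l := by linarith
  -- Domination by `K` is obtained at the larger of two radii, so the threshold moves out by the
  -- factor `l`.
  refine ⟨l * R, C, by positivity, hC, fun r hr => ?_⟩
  have e : l * (r / l) = r := by field_simp
  have hr' : R < r / l := by
    rw [lt_div_iff₀ hl0, mul_comm]; exact hr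
  have := h1 (r / l) hr' (by
    rw [e]; exact (lt_mul_of_one_lt_left hR hl).trans hr)
  rwa [e] at this

/-- Iterate down from `r` to a radius in `[r₀, l * r₀)`. What remains is a bounded boundary term,
absorbed because `r² L(r)` stays bounded below when `a + 2 > 0`. -/
lemma add_le_L_Ioi_of_L (h : IsPruittPair K L c) {a R : ℝ} (hR : 0 < R) (ha : -2 < a)
    (hL : ∀ r ∈ Ioi R, 0 < L r) (hb : LowerPowerBound (Ioi R) L a) :
    ∃ R' C : ℝ, 0 < R' ∧ 0 < C ∧ ∀ r ∈ Ioi R', K r + L r ≤ C * L r := by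
  obtain ⟨l, C, hl, hC, h1⟩ := h.sq_mul_K_le (s := Ioi R) (fun r hr => hR.trans hr) ha hL hb
  have hl0 : 0 < l := by linarith
  obtain ⟨A, hA, hb⟩ := hb
  set r₀ := l * R with hr₀
  have hRr₀ : R < r₀ := lt_mul_of_one_lt_left hR hl
  have hr₀0 : 0 < r₀ := hR.trans hRr₀
  have hLr₀ := hL r₀ hRr₀
  have hf := h.K_pos (l * r₀) (by positivity)
  -- The ratio of the upper bound for the boundary term to the lower bound `A * r₀ ^ 2 * L r₀` for
  -- `r ^ 2 * L r`.
  set D := (l * r₀) ^ 2 * K (l * r₀) / (A * r₀ ^ 2 * L r₀) with hD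
  have hD0 : 0 < D := by positivity
  refine ⟨r₀, D + C + 1, hr₀0, by positivity, fun r hr => ?_⟩
  have hr0 : 0 < r := hr₀0.trans hr
  have hRr : R < r := hRr₀.trans hr
  have hLr := hL r hRr
  obtain ⟨n, hn1, hn2⟩ := exists_pow_scale hl hr₀0 (le_of_lt hr)
  have hln : 0 < l ^ n := by positivity
  have e : l ^ n * (r / l ^ n) = r := by field_simp
  have h2 := h1 n (r / l ^ n) (hRr₀.trans_le (by rw [le_div_iff₀ hln, mul_comm]; exact hn1))
    (by rw [e]; exact hRr)
  rw [e] at h2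
  have h3 : (r / l ^ n) ^ 2 * K (r / l ^ n) ≤ (l * r₀) ^ 2 * K (l * r₀) :=
    h.sq_mul_K_mono (by positivity) (by
      rw [div_le_iff₀ hln]
      calc r ≤ l ^ (n + 1) * r₀ := hn2.le
        _ = _ := by ring)
  have h4 : A * r₀ ^ 2 * L r₀ ≤ r ^ 2 * L r := by
    have h5 := hb r₀ hRr₀ r hRr hr
    rw [le_div_iff₀ hLr₀] at h5
    have h6 : (1 : ℝ) ≤ (r / r₀) ^ (a + 2) :=
      Real.one_le_rpow ((one_le_div hr₀0).2 (le_of_lt hr)) (by linarith)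
    have h7 : (r / r₀) ^ (a + 2) = (r / r₀) ^ a * (r / r₀) ^ 2 := by
      rw [Real.rpow_add (by positivity)]; norm_num
    calc A * r₀ ^ 2 * L r₀ ≤ A * r₀ ^ 2 * L r₀ * (r / r₀) ^ (a + 2) :=
          le_mul_of_one_le_right (by positivity) h6
      _ = r ^ 2 * (A * (r / r₀) ^ a * L r₀) := by rw [h7]; field_simp
      _ ≤ _ := mul_le_mul_of_nonneg_left h5 (by positivity)
  have h5 : (l * r₀) ^ 2 * K (l * r₀) ≤ D * (r ^ 2 * L r) := by
    rw [hD, div_mul_eq_mul_div, le_div_iff₀ (by positivity)]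
    exact mul_le_mul_of_nonneg_left h4 (by positivity)
  have h6 : r ^ 2 * (K r + L r) ≤ r ^ 2 * ((D + C + 1) * L r) := by linarith
  exact le_of_mul_le_mul_left h6 (by positivity)

/-- The iteration runs outwards for ever, and its boundary term vanishes since `L` tends to zero. -/
lemma add_le_K_Ioi_of_K (h : IsPruittPair K L c) {b R : ℝ} (hR : 0 < R) (hb0 : b < 0)
    (hb : UpperPowerBound (Ioi R) K b) :
    ∃ C : ℝ, 0 < C ∧ ∀ r ∈ Ioi R, K r + L r ≤ C * K r := by
  obtain ⟨l, C, hl, hC, h1⟩ := h.L_le_add (s := Ioi R) (fun r hr => hR.trans hr) hb0 hb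
  refine ⟨C + 1, by positivity, fun r hr => ?_⟩
  have hr0 : 0 < r := hR.trans hr
  have ht : Tendsto (fun n : ℕ => L (l ^ n * r) + C * K r) atTop (𝓝 (0 + C * K r)) :=
    (h.tendsto_L.comp ((tendsto_pow_atTop_atTop_of_one_lt hl).atTop_mul_const hr0)).add_const _
  have : L r ≤ 0 + C * K r := ge_of_tendsto' ht fun n =>
    h1 n r hr (lt_of_lt_of_le hr (le_mul_of_one_le_left hr0.le (one_le_pow₀ hl.le)))
  linarith

/-! #### Domination near zero -/

lemma add_le_L_Ioo (h : IsPruittPair K L c) {a R : ℝ} (hR : 0 < R) (ha : -2 < a)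
    (hb : LowerPowerBound (Ioo 0 R) (fun r => K r + L r) a) :
    ∃ R' C : ℝ, 0 < R' ∧ 0 < C ∧ ∀ r ∈ Ioo 0 R', K r + L r ≤ C * L r := by
  obtain ⟨l, C, hl, hC, h1⟩ := h.add_le_L (fun r hr => hr.1) ha hb
  have hl0 : 0 < l := by linarith
  refine ⟨R / l, C, by positivity, hC, fun r hr =>
    h1 r ⟨hr.1, ?_⟩ ⟨by have := hr.1; positivity, ?_⟩⟩
  · exact hr.2.trans_le (div_le_self hR.le hl.le)
  · rw [mul_comm, ← lt_div_iff₀ hl0]; exact hr.2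

lemma add_le_K_Ioo (h : IsPruittPair K L c) {b R : ℝ} (hb0 : b < 0)
    (hb : UpperPowerBound (Ioo 0 R) (fun r => K r + L r) b) :
    ∃ C : ℝ, 0 < C ∧ ∀ r ∈ Ioo 0 R, K r + L r ≤ C * K r := by
  obtain ⟨l, C, hl, hC, h1⟩ := h.add_le_K (fun r hr => hr.1) hb0 hb
  have hl0 : 0 < l := by linarith
  refine ⟨C, hC, fun r hr => ?_⟩
  have hr0 := hr.1
  have e : l * (r / l) = r := by field_simp
  have := h1 (r / l) ⟨by positivity, (div_le_self hr0.le hl.le).trans_lt hr.2⟩ (by rwa [e])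
  rwa [e] at this

/-- The bound forces `K(r) ≤ D r ^ a` near zero, so `r² K(r)` tends to zero because `a > -2`. For
the Lévy process this excludes a Gaussian part. -/
lemma nonpos_of_lowerPowerBound (h : IsPruittPair K L c) {a R : ℝ} (hR : 0 < R) (ha : -2 < a)
    (hb : LowerPowerBound (Ioo 0 R) (fun r => K r + L r) a) : c ≤ 0 := by
  obtain ⟨A, hA, hb⟩ := hb
  set s := R / 2 with hs
  have hs0 : 0 < s := by positivity
  have hsR : s < R := by rw [hs]; linarith
  set D := A⁻¹ * s ^ (-a) * (K s + L s) with hD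
  have ht : Tendsto (fun r : ℝ => D * r ^ (a + 2)) (𝓝[>] 0) (𝓝 (D * 0)) := by
    refine Tendsto.const_mul _ (tendsto_nhdsWithin_of_tendsto_nhds ?_)
    have := (Real.continuousAt_rpow_const 0 (a + 2) (Or.inr (by linarith))).tendsto
    rwa [Real.zero_rpow (by linarith)] at this
  rw [mul_zero] at ht
  refine le_of_tendsto_of_tendsto h.tendsto_K ht ?_
  filter_upwards [Ioo_mem_nhdsGT hs0] with r hr
  have hr0 : 0 < r := hr.1
  have h1 := hb r ⟨hr0, hr.2.trans hsR⟩ s ⟨hs0, hsR⟩ hr.2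
  rw [le_div_iff₀ (h.add_pos hr0), Real.div_rpow hs0.le hr0.le] at h1
  have h2 : K r + L r ≤ D * r ^ a := by
    have p1 : 0 < s ^ a := by positivity
    have p2 : 0 < r ^ a := by positivity
    calc K r + L r = A⁻¹ * s ^ (-a) * (A * (s ^ a / r ^ a) * (K r + L r)) * r ^ a := by
          rw [Real.rpow_neg hs0.le]; field_simp
      _ ≤ A⁻¹ * s ^ (-a) * (K s + L s) * r ^ a := by gcongr
  have h3 : r ^ (a + 2) = r ^ a * r ^ 2 := by
    rw [Real.rpow_add hr0]; norm_num
  have h4 : K r ≤ D * r ^ a := by linarith [h.L_nonneg r hr0]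
  calc r ^ 2 * K r ≤ r ^ 2 * (D * r ^ a) := by gcongr
    _ = _ := by rw [h3]; ring

/-- The iteration runs inwards to zero; the boundary term is the limit of `r² K(r)`, and this is
where its vanishing is needed. -/
lemma add_le_L_Ioo_of_L (h : IsPruittPair K L 0) {a R : ℝ} (ha : -2 < a)
    (hL : ∀ r ∈ Ioo 0 R, 0 < L r) (hb : LowerPowerBound (Ioo 0 R) L a) :
    ∃ C : ℝ, 0 < C ∧ ∀ r ∈ Ioo 0 R, K r + L r ≤ C * L r := by
  obtain ⟨l, C, hl, hC, h1⟩ := h.sq_mul_K_le (fun r hr => hr.1) ha hL hb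
  have hl0 : 0 < l := by linarith
  refine ⟨C + 1, by positivity, fun r hr => ?_⟩
  have hr0 : 0 < r := hr.1
  have h2 : Tendsto (fun n : ℕ => r / l ^ n) atTop (𝓝[>] 0) := by
    refine tendsto_nhdsWithin_of_tendsto_nhds_of_eventually_within _
      ((tendsto_pow_atTop_atTop_of_one_lt hl).const_div_atTop r) (Eventually.of_forall fun n => ?_)
    exact div_pos hr0 (by positivity)
  have ht := (h.tendsto_K.comp h2).add_const (C * (r ^ 2 * L r))
  have h3 : r ^ 2 * K r ≤ 0 + C * (r ^ 2 * L r) := ge_of_tendsto' ht fun n => by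
    have hln : 0 < l ^ n := by positivity
    have e : l ^ n * (r / l ^ n) = r := by field_simp
    have := h1 n (r / l ^ n) ⟨by positivity,
      (div_le_self hr0.le (one_le_pow₀ hl.le)).trans_lt hr.2⟩ (by rwa [e])
    rwa [e] at this
  have h6 : r ^ 2 * (K r + L r) ≤ r ^ 2 * ((C + 1) * L r) := by linarith
  exact le_of_mul_le_mul_left h6 (by positivity)

lemma add_le_K_Ioo_of_K (h : IsPruittPair K L c) {b R : ℝ} (hR : 0 < R) (hb0 : b < 0)
    (hb : UpperPowerBound (Ioo 0 R) K b) :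
    ∃ R' C : ℝ, 0 < R' ∧ 0 < C ∧ ∀ r ∈ Ioo 0 R', K r + L r ≤ C * K r := by
  obtain ⟨l, C, hl, hC, h1⟩ := h.L_le_add (fun r hr => hr.1) hb0 hb
  have hl0 : 0 < l := by linarith
  obtain ⟨B, hB, hb⟩ := hb
  set r₀ := R / 2 with hr₀
  have hr₀0 : 0 < r₀ := by positivity
  have hr₀R : r₀ < R := by rw [hr₀]; linarith
  have hK₀ := h.K_pos r₀ hr₀0
  -- The iteration stops between `r₀ / l` and `r₀`, so `M` bounds the remaining tail. It is absorbed
  -- because `K r ≥ K r₀ / B`.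
  set M := L (r₀ / l) with hM
  have hM0 : 0 ≤ M := h.L_nonneg _ (by positivity)
  refine ⟨r₀, M * B / K r₀ + C + 1, hr₀0, by positivity, fun r hr => ?_⟩
  have hr0 : 0 < r := hr.1
  have hKr := h.K_pos r hr0
  obtain ⟨n, hn1, hn2⟩ := exists_pow_scale hl hr0 hr.2.le
  have h2 := h1 n r ⟨hr0, hr.2.trans hr₀R⟩ ⟨by positivity, hn1.trans_lt hr₀R⟩
  have h3 : L (l ^ n * r) ≤ M := h.L_antitone _ _ (by positivity) (by
    rw [div_le_iff₀ hl0]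
    calc r₀ ≤ l ^ (n + 1) * r := hn2.le
      _ = _ := by ring)
  have h4 : K r₀ ≤ B * K r := by
    have h5 := hb r ⟨hr0, hr.2.trans hr₀R⟩ r₀ ⟨hr₀0, hr₀R⟩ hr.2
    rw [div_le_iff₀ hKr] at h5
    have h6 : (r₀ / r) ^ b ≤ 1 :=
      Real.rpow_le_one_of_one_le_of_nonpos ((one_le_div hr0).2 hr.2.le) hb0.le
    calc K r₀ ≤ B * (r₀ / r) ^ b * K r := h5
      _ ≤ B * 1 * K r := by gcongr
      _ = _ := by ring
  have h5 : M ≤ M * B / K r₀ * K r := by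
    rw [div_mul_eq_mul_div, le_div_iff₀ hK₀, mul_assoc]
    exact mul_le_mul_of_nonneg_left h4 hM0
  linarith

/-! #### Extension of the comparisons to fixed ranges -/

lemma comparableOn_of_add_le (h : IsPruittPair K L c) {s : Set ℝ} (hs : s ⊆ Ioi 0) {F : ℝ → ℝ}
    (hF : F = K ∨ F = L) {C : ℝ} (hC : ∀ r ∈ s, K r + L r ≤ C * F r) :
    ComparableOn s F (fun r => K r + L r) := by
  refine ⟨max C 1, by positivity, fun r hr => ?_⟩
  have hr0 : 0 < r := hs hr
  have hK := (h.K_pos r hr0).le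
  have hL := h.L_nonneg r hr0
  have hF0 : 0 ≤ F r ∧ F r ≤ K r + L r := by
    rcases hF with rfl | rfl
    · exact ⟨hK, by linarith⟩
    · exact ⟨hL, by linarith⟩
  constructor
  · rw [inv_mul_le_iff₀ (by positivity)]
    exact (hC r hr).trans (mul_le_mul_of_nonneg_right (le_max_left _ _) hF0.1)
  · exact hF0.2.trans (le_mul_of_one_le_left (by linarith) (le_max_right _ _))

/-- Between `S` and `R`, monotonicity bounds `K + L` by its value at `S` and `L` from below by `L
m`; the latter is positive since `L` dominates at `m > R`. -/
lemma comparableOn_L_Ioi (h : IsPruittPair K L c) {R C : ℝ} (hR : 0 < R)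
    (hC : ∀ r ∈ Ioi R, K r + L r ≤ C * L r) {S : ℝ} (hS : 0 < S) :
    ComparableOn (Ioi S) L (fun r => K r + L r) := by
  set m := max R S + 1 with hm
  have hmR : R < m := by have := le_max_left R S; linarith
  have hm0 : 0 < m := hR.trans hmR
  have hLm : 0 < L m := by
    have h1 := (h.add_pos hm0).trans_le (hC m hmR)
    exact (h.L_nonneg m hm0).lt_of_ne' fun h0 => by simp [h0] at h1
  refine h.comparableOn_of_add_le (C := max C ((K S + L S) / L m)) (fun r hr => hS.trans hr)
    (Or.inr rfl) fun r hr => ?_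
  have hr0 : 0 < r := hS.trans hr
  rcases lt_or_ge R r with hRr | hRr
  · exact (hC r hRr).trans (mul_le_mul_of_nonneg_right (le_max_left _ _) (h.L_nonneg r hr0))
  · calc K r + L r ≤ K S + L S := h.add_antitone hS (le_of_lt hr)
      _ = (K S + L S) / L m * L m := by field_simp
      _ ≤ (K S + L S) / L m * L r :=
        mul_le_mul_of_nonneg_left (h.L_antitone r m hr0 (hRr.trans hmR.le))
          (div_nonneg (h.add_pos hS).le hLm.le)
      _ ≤ _ := mul_le_mul_of_nonneg_right (le_max_right _ _) (h.L_nonneg r hr0)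

lemma comparableOn_L_Ioo (h : IsPruittPair K L c) {R C : ℝ} (hR : 0 < R)
    (hC : ∀ r ∈ Ioo 0 R, K r + L r ≤ C * L r) {S : ℝ} (hLS : 0 < L S) :
    ComparableOn (Ioo 0 S) L (fun r => K r + L r) := by
  refine h.comparableOn_of_add_le (C := max C ((K R + L R) / L S)) (fun r hr => hr.1)
    (Or.inr rfl) fun r hr => ?_
  have hr0 : 0 < r := hr.1
  rcases lt_or_ge r R with hRr | hRr
  · exact (hC r ⟨hr0, hRr⟩).trans
      (mul_le_mul_of_nonneg_right (le_max_left _ _) (h.L_nonneg r hr0))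
  · calc K r + L r ≤ K R + L R := h.add_antitone hR hRr
      _ = (K R + L R) / L S * L S := by field_simp
      _ ≤ (K R + L R) / L S * L r :=
        mul_le_mul_of_nonneg_left (h.L_antitone r S hr0 hr.2.le)
          (div_nonneg (h.add_pos hR).le hLS.le)
      _ ≤ _ := mul_le_mul_of_nonneg_right (le_max_right _ _) (h.L_nonneg r hr0)

/-- `K` itself need not be monotone, but `r² K(r)` is; on a compact range this costs only the factor
`M² / m²`. -/
lemma add_le_mul_K_Icc (h : IsPruittPair K L c) {m M r : ℝ} (hm : 0 < m) (hr : r ∈ Icc m M) :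
    K r + L r ≤ (K m + L m) * M ^ 2 / (m ^ 2 * K m) * K r := by
  have hr0 : 0 < r := hm.trans_le hr.1
  have hKm := h.K_pos m hm
  have hKr := h.K_pos r hr0
  have hhm := h.add_pos hm
  calc K r + L r ≤ K m + L m := h.add_antitone hm hr.1
    _ = (K m + L m) / (m ^ 2 * K m) * (m ^ 2 * K m) := by field_simp
    _ ≤ (K m + L m) / (m ^ 2 * K m) * (r ^ 2 * K r) := by
      gcongr 1
      exact h.sq_mul_K_mono hm hr.1
    _ ≤ (K m + L m) / (m ^ 2 * K m) * (M ^ 2 * K r) := by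
      have := hr.2
      gcongr
    _ = _ := by ring

lemma comparableOn_K_Ioi (h : IsPruittPair K L c) {R C : ℝ}
    (hC : ∀ r ∈ Ioi R, K r + L r ≤ C * K r) {S : ℝ} (hS : 0 < S) :
    ComparableOn (Ioi S) K (fun r => K r + L r) := by
  refine h.comparableOn_of_add_le (C := max C ((K S + L S) * R ^ 2 / (S ^ 2 * K S)))
    (fun r hr => hS.trans hr) (Or.inl rfl) fun r hr => ?_
  have hKr := (h.K_pos r (hS.trans hr)).le
  rcases lt_or_ge R r with hRr | hRr
  · exact (hC r hRr).trans (mul_le_mul_of_nonneg_right (le_max_left _ _) hKr)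
  · exact (h.add_le_mul_K_Icc hS ⟨le_of_lt hr, hRr⟩).trans
      (mul_le_mul_of_nonneg_right (le_max_right _ _) hKr)

lemma comparableOn_K_Ioo (h : IsPruittPair K L c) {R C : ℝ} (hR : 0 < R)
    (hC : ∀ r ∈ Ioo 0 R, K r + L r ≤ C * K r) {S : ℝ} :
    ComparableOn (Ioo 0 S) K (fun r => K r + L r) := by
  refine h.comparableOn_of_add_le (C := max C ((K R + L R) * S ^ 2 / (R ^ 2 * K R)))
    (fun r hr => hr.1) (Or.inl rfl) fun r hr => ?_
  have hKr := (h.K_pos r hr.1).le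
  rcases lt_or_ge r R with hRr | hRr
  · exact (hC r ⟨hr.1, hRr⟩).trans (mul_le_mul_of_nonneg_right (le_max_left _ _) hKr)
  · exact (h.add_le_mul_K_Icc hR ⟨hRr, hr.2.le⟩).trans
      (mul_le_mul_of_nonneg_right (le_max_right _ _) hKr)

/-! #### Indices -/

lemma comparableOn_L_of_lowerIndexAtInfinity (h : IsPruittPair K L c) {α S : ℝ} (hα : -2 < α)
    (hi : HasLowerIndexAtInfinity (fun r => K r + L r) α) (hS : 0 < S) :
    ComparableOn (Ioi S) L (fun r => K r + L r) := by
  -- The index itself need not be an admissible exponent; one strictly above `-2` is all that is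
  -- used.
  obtain ⟨a, ⟨R, hR, hb⟩, ha, -⟩ := (hasLowerIndexAtInfinity_iff.1 hi).2.exists_between hα
  obtain ⟨C, -, hC⟩ := h.add_le_L_Ioi hR ha hb
  exact h.comparableOn_L_Ioi hR hC hS

lemma hasLowerIndexAtInfinity_add_iff (h : IsPruittPair K L c) {α : ℝ} (hα : -2 < α) :
    HasLowerIndexAtInfinity (fun r => K r + L r) α ↔ HasLowerIndexAtInfinity L α := by
  constructor
  · intro hi
    exact hi.of_comparableOn (h.comparableOn_L_of_lowerIndexAtInfinity hα hi one_pos).symm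
  · intro hi
    obtain ⟨⟨R₀, hR₀, hL⟩, hlub⟩ := hasLowerIndexAtInfinity_iff.1 hi
    obtain ⟨a, ⟨R, hR, hb⟩, ha, -⟩ := hlub.exists_between hα
    obtain ⟨R', C, hR', -, hC⟩ := h.add_le_L_Ioi_of_L (R := max R R₀)
      (hR.trans_le (le_max_left _ _))
      ha (fun r hr => hL r (Ioi_subset_Ioi (le_max_right _ _) hr))
      (hb.mono (Ioi_subset_Ioi (le_max_left _ _)))
    exact hi.of_comparableOn (h.comparableOn_L_Ioi hR' hC one_pos)

lemma comparableOn_K_of_upperIndexAtInfinity (h : IsPruittPair K L c) {β S : ℝ} (hβ : β < 0)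
    (hi : HasUpperIndexAtInfinity (fun r => K r + L r) β) (hS : 0 < S) :
    ComparableOn (Ioi S) K (fun r => K r + L r) := by
  obtain ⟨b, ⟨R, hR, hb⟩, -, hb0⟩ := (hasUpperIndexAtInfinity_iff.1 hi).2.exists_between hβ
  obtain ⟨R', C, hR', -, hC⟩ := h.add_le_K_Ioi hR hb0 hb
  exact h.comparableOn_K_Ioi hC hS

lemma hasUpperIndexAtInfinity_add_iff (h : IsPruittPair K L c) {β : ℝ} (hβ : β < 0) :
    HasUpperIndexAtInfinity (fun r => K r + L r) β ↔ HasUpperIndexAtInfinity K β := by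
  constructor
  · intro hi
    exact hi.of_comparableOn (h.comparableOn_K_of_upperIndexAtInfinity hβ hi one_pos).symm
  · intro hi
    obtain ⟨b, ⟨R, hR, hb⟩, -, hb0⟩ := (hasUpperIndexAtInfinity_iff.1 hi).2.exists_between hβ
    obtain ⟨C, -, hC⟩ := h.add_le_K_Ioi_of_K hR hb0 hb
    exact hi.of_comparableOn (h.comparableOn_K_Ioi hC one_pos)

lemma nonpos_and_exists_add_le_L (h : IsPruittPair K L c) {α : ℝ} (hα : -2 < α)
    (hi : HasLowerIndexAtZero (fun r => K r + L r) α) :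
    c ≤ 0 ∧ ∃ R C : ℝ, 0 < R ∧ ∀ r ∈ Ioo 0 R, K r + L r ≤ C * L r := by
  obtain ⟨a, ⟨R, hR, hb⟩, ha, -⟩ := (hasLowerIndexAtZero_iff.1 hi).2.exists_between hα
  obtain ⟨R', C, hR', -, hC⟩ := h.add_le_L_Ioo hR ha hb
  exact ⟨h.nonpos_of_lowerPowerBound hR ha hb, R', C, hR', hC⟩

lemma hasLowerIndexAtZero_add_iff (h : IsPruittPair K L c) (hc : 0 ≤ c) {α : ℝ} (hα : -2 < α) :
    HasLowerIndexAtZero (fun r => K r + L r) α ↔ c = 0 ∧ HasLowerIndexAtZero L α := by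
  constructor
  · intro hi
    obtain ⟨hc0, R, C, hR, hC⟩ := h.nonpos_and_exists_add_le_L hα hi
    exact ⟨le_antisymm hc0 hc, hi.of_comparableOn hR
      (h.comparableOn_of_add_le (fun r hr => hr.1) (Or.inr rfl) hC).symm⟩
  · rintro ⟨rfl, hi⟩
    obtain ⟨⟨R₀, hR₀, hL⟩, hlub⟩ := hasLowerIndexAtZero_iff.1 hi
    obtain ⟨a, ⟨R, hR, hb⟩, ha, -⟩ := hlub.exists_between hα
    obtain ⟨C, -, hC⟩ := h.add_le_L_Ioo_of_L (R := min R R₀) ha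
      (fun r hr => hL r ⟨hr.1, hr.2.trans_le (min_le_right _ _)⟩)
      (hb.mono (Ioo_subset_Ioo_right (min_le_left _ _)))
    exact hi.of_comparableOn (lt_min hR hR₀)
      (h.comparableOn_of_add_le (fun r hr => hr.1) (Or.inr rfl) hC)

lemma comparableOn_K_of_upperIndexAtZero (h : IsPruittPair K L c) {β S : ℝ} (hβ : β < 0)
    (hi : HasUpperIndexAtZero (fun r => K r + L r) β) :
    ComparableOn (Ioo 0 S) K (fun r => K r + L r) := by
  obtain ⟨b, ⟨R, hR, hb⟩, -, hb0⟩ := (hasUpperIndexAtZero_iff.1 hi).2.exists_between hβ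
  obtain ⟨C, -, hC⟩ := h.add_le_K_Ioo hb0 hb
  exact h.comparableOn_K_Ioo hR hC

lemma hasUpperIndexAtZero_add_iff (h : IsPruittPair K L c) {β : ℝ} (hβ : β < 0) :
    HasUpperIndexAtZero (fun r => K r + L r) β ↔ HasUpperIndexAtZero K β := by
  constructor
  · intro hi
    exact hi.of_comparableOn one_pos (h.comparableOn_K_of_upperIndexAtZero hβ hi).symm
  · intro hi
    obtain ⟨b, ⟨R, hR, hb⟩, -, hb0⟩ := (hasUpperIndexAtZero_iff.1 hi).2.exists_between hβ
    obtain ⟨R', C, hR', -, hC⟩ := h.add_le_K_Ioo_of_K hR hb0 hb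
    exact hi.of_comparableOn one_pos (h.comparableOn_K_Ioo hR' hC)

end IsPruittPair

/-! ### Integrals with respect to a Lévy measure -/

namespace IsLevyMeasure

variable {d : ℕ} {N : Measure (EuclideanSpace ℝ (Fin d))}

lemma integrable_min (hN : IsLevyMeasure N) :
    Integrable (fun y : EuclideanSpace ℝ (Fin d) => min 1 (‖y‖ ^ 2)) N := by
  refine ⟨by fun_prop, ?_⟩
  rw [hasFiniteIntegral_iff_ofReal (Eventually.of_forall fun y => by positivity)]
  exact hN.2

lemma integrableOn_norm_sq (hN : IsLevyMeasure N) (r : ℝ) :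
    IntegrableOn (fun y : EuclideanSpace ℝ (Fin d) => ‖y‖ ^ 2) (Metric.ball 0 r) N := by
  refine Integrable.mono' (g := fun y => (1 + r ^ 2) * min 1 (‖y‖ ^ 2))
    (hN.integrable_min.const_mul _).integrableOn (by fun_prop) ?_
  filter_upwards [ae_restrict_mem measurableSet_ball] with y hy
  rw [mem_ball_zero_iff] at hy
  have h2 : ‖y‖ ^ 2 ≤ r ^ 2 := by gcongr
  rw [Real.norm_of_nonneg (by positivity)]
  rcases min_cases 1 (‖y‖ ^ 2) with ⟨h, -⟩ | ⟨h, -⟩ <;> rw [h] <;>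
    nlinarith [sq_nonneg r, sq_nonneg ‖y‖, mul_nonneg (sq_nonneg r) (sq_nonneg ‖y‖)]

lemma measure_compl_ball_lt_top (hN : IsLevyMeasure N) {r : ℝ} (hr : 0 < r) :
    N (Metric.ball 0 r)ᶜ < ∞ := by
  have h := hN.integrable_min.measure_ge_lt_top (ε := min 1 (r ^ 2)) (by positivity)
  refine (measure_mono fun y hy => ?_).trans_lt h
  have hy' : r ≤ ‖y‖ := by simpa using hy
  exact min_le_min_left _ (pow_le_pow_left₀ hr.le hy' 2)

/-- With `x = ⟨y, z⟩`, the compensated term is at most `x²` for `|x| ≤ 1` by Taylor, and at most `2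
+ |x| ≤ 3x²` otherwise. Outside the unit ball the bound 2 suffices. -/
lemma norm_levyKhintchine_integrand_le (y z : EuclideanSpace ℝ (Fin d)) :
    ‖1 - Complex.exp (Complex.I * (inner ℝ y z : ℝ)) +
      (Metric.ball (0 : EuclideanSpace ℝ (Fin d)) 1).indicator
        (fun y => Complex.I * (inner ℝ y z : ℝ)) y‖ ≤ (3 * ‖z‖ ^ 2 + 2) * min 1 (‖y‖ ^ 2) := by
  set x : ℝ := inner ℝ y z with hx
  have hxn : ‖Complex.I * (x : ℂ)‖ = |x| := by simp
  have hexp : ‖Complex.exp (Complex.I * (x : ℂ))‖ = 1 := by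
    rw [mul_comm]; exact Complex.norm_exp_ofReal_mul_I x
  by_cases hy : y ∈ Metric.ball (0 : EuclideanSpace ℝ (Fin d)) 1
  · rw [indicator_of_mem hy]
    have hy1 : ‖y‖ < 1 := by simpa using hy
    have hxle : |x| ^ 2 ≤ ‖y‖ ^ 2 * ‖z‖ ^ 2 := by
      rw [← mul_pow]
      gcongr
      exact abs_real_inner_le_norm y z
    have h1 : ‖1 - Complex.exp (Complex.I * x) + Complex.I * x‖ ≤ 3 * |x| ^ 2 := by
      rcases le_or_gt |x| 1 with hx1 | hx1
      · have := Complex.norm_exp_sub_one_sub_id_le (x := Complex.I * x) (by rwa [hxn])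
        rw [← norm_neg, hxn] at this
        have e : -(Complex.exp (Complex.I * x) - 1 - Complex.I * x) =
          1 - Complex.exp (Complex.I * x) + Complex.I * x := by ring
        rw [e] at this
        nlinarith [sq_nonneg |x|]
      · have h2 := norm_add_le (1 - Complex.exp (Complex.I * x)) (Complex.I * x)
        have h3 := norm_sub_le 1 (Complex.exp (Complex.I * x))
        rw [hexp, norm_one] at h3
        rw [hxn] at h2
        nlinarith
    rw [min_eq_right (by nlinarith [norm_nonneg y])]
    nlinarith [sq_nonneg ‖y‖]
  · rw [indicator_of_notMem hy, add_zero]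
    have hy1 : 1 ≤ ‖y‖ := by simpa using hy
    rw [min_eq_left (by nlinarith)]
    have h3 := norm_sub_le 1 (Complex.exp (Complex.I * x))
    rw [hexp, norm_one] at h3
    nlinarith [sq_nonneg ‖z‖]

lemma integrable_levyKhintchine_integrand (hN : IsLevyMeasure N)
    (z : EuclideanSpace ℝ (Fin d)) :
    Integrable (fun y => 1 - Complex.exp (Complex.I * (inner ℝ y z : ℝ)) +
      (Metric.ball (0 : EuclideanSpace ℝ (Fin d)) 1).indicator
        (fun y => Complex.I * (inner ℝ y z : ℝ)) y) N := by
  refine Integrable.mono' (hN.integrable_min.const_mul (3 * ‖z‖ ^ 2 + 2)) ?_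
    (Eventually.of_forall fun y => norm_levyKhintchine_integrand_le y z)
  refine AEStronglyMeasurable.add (by fun_prop)
    (AEStronglyMeasurable.indicator ?_ measurableSet_ball)
  fun_prop

lemma re_levyKhintchine_integrand (y z : EuclideanSpace ℝ (Fin d)) :
    (1 - Complex.exp (Complex.I * (inner ℝ y z : ℝ)) +
      (Metric.ball (0 : EuclideanSpace ℝ (Fin d)) 1).indicator
        (fun y => Complex.I * (inner ℝ y z : ℝ)) y).re = 1 - Real.cos (inner ℝ y z) := by
  have h : ((Metric.ball (0 : EuclideanSpace ℝ (Fin d)) 1).indicator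
        (fun y => Complex.I * ((inner ℝ y z : ℝ) : ℂ)) y).re = 0 := by
    by_cases hy : y ∈ Metric.ball (0 : EuclideanSpace ℝ (Fin d)) 1
    · rw [indicator_of_mem hy]; simp
    · rw [indicator_of_notMem hy]; simp
  rw [Complex.add_re, h, mul_comm, Complex.sub_re, Complex.exp_ofReal_mul_I_re]
  simp

lemma integrable_one_sub_cos (hN : IsLevyMeasure N) (z : EuclideanSpace ℝ (Fin d)) :
    Integrable (fun y => 1 - Real.cos (inner ℝ y z)) N := by
  simpa only [re_levyKhintchine_integrand, RCLike.re_to_complex] using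
    (hN.integrable_levyKhintchine_integrand z).re

/-- The compensator is purely imaginary, so it disappears from the real part. -/
lemma re_levyKhintchineExponent (hN : IsLevyMeasure N) (σ : ℝ)
    (z : EuclideanSpace ℝ (Fin d)) :
    (levyKhintchineExponent 0 (σ ^ 2 • ContinuousLinearMap.id ℝ (EuclideanSpace ℝ (Fin d))) N
      z).re = σ ^ 2 * ‖z‖ ^ 2 + ∫ y, (1 - Real.cos (inner ℝ y z)) ∂N := by
  have h := integral_re (hN.integrable_levyKhintchine_integrand z)
  simp only [RCLike.re_to_complex, re_levyKhintchine_integrand] at h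
  rw [levyKhintchineExponent, Complex.add_re, ← h]
  congr 1
  simp [inner_smul_right, -Complex.ofReal_pow]

/-! ### Truncated second moments and tails. -/

/-- The truncated second moment of a Lévy measure. -/
noncomputable def secondMoment (N : Measure (EuclideanSpace ℝ (Fin d))) (r : ℝ) : ℝ :=
  ∫ y in Metric.ball 0 r, ‖y‖ ^ 2 ∂N

lemma secondMoment_nonneg (N : Measure (EuclideanSpace ℝ (Fin d))) (r : ℝ) :
    0 ≤ secondMoment N r :=
  integral_nonneg fun y => by positivity

lemma measureReal_annulus (hN : IsLevyMeasure N) {r s : ℝ} (hr : 0 < r) (hrs : r ≤ s) :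
    N.real (Metric.ball 0 s \ Metric.ball 0 r) =
      N.real (Metric.ball 0 r)ᶜ - N.real (Metric.ball 0 s)ᶜ := by
  rw [← measureReal_sdiff (compl_subset_compl.2 (Metric.ball_subset_ball hrs))
    measurableSet_ball.compl (hN.measure_compl_ball_lt_top hr).ne]
  congr 1
  ext y
  simp [and_comm]

lemma secondMoment_sub (hN : IsLevyMeasure N) {r s : ℝ} (hrs : r ≤ s) :
    secondMoment N s - secondMoment N r =
      ∫ y in Metric.ball 0 s \ Metric.ball 0 r, ‖y‖ ^ 2 ∂N :=
  (setIntegral_sdiff measurableSet_ball (hN.integrableOn_norm_sq s)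
    (Metric.ball_subset_ball hrs)).symm

lemma measure_annulus_lt_top (hN : IsLevyMeasure N) {r : ℝ} (hr : 0 < r) (s : ℝ) :
    N (Metric.ball 0 s \ Metric.ball 0 r) < ∞ :=
  (measure_mono (sdiff_subset_compl _ _)).trans_lt (hN.measure_compl_ball_lt_top hr)

/-- On the annulus, `r² ≤ ‖y‖² < s²`. This and the next lemma are the integrated form of `d(r² K) =
-r² dL`. -/
lemma le_secondMoment_sub (hN : IsLevyMeasure N) {r s : ℝ} (hr : 0 < r) (hrs : r ≤ s) :
    r ^ 2 * (N.real (Metric.ball 0 r)ᶜ - N.real (Metric.ball 0 s)ᶜ) ≤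
      secondMoment N s - secondMoment N r := by
  rw [hN.secondMoment_sub hrs, ← hN.measureReal_annulus hr hrs, mul_comm, ← smul_eq_mul,
    ← setIntegral_const]
  refine setIntegral_mono_on (integrableOn_const (hN.measure_annulus_lt_top hr s).ne)
    ((hN.integrableOn_norm_sq s).mono_set sdiff_subset)
    (measurableSet_ball.diff measurableSet_ball) fun y hy => ?_
  have : r ≤ ‖y‖ := by simpa using hy.2
  gcongr

lemma secondMoment_sub_le (hN : IsLevyMeasure N) {r s : ℝ} (hr : 0 < r) (hrs : r ≤ s) :
    secondMoment N s - secondMoment N r ≤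
      s ^ 2 * (N.real (Metric.ball 0 r)ᶜ - N.real (Metric.ball 0 s)ᶜ) := by
  rw [hN.secondMoment_sub hrs, ← hN.measureReal_annulus hr hrs, mul_comm, ← smul_eq_mul,
    ← setIntegral_const]
  refine setIntegral_mono_on ((hN.integrableOn_norm_sq s).mono_set sdiff_subset)
    (integrableOn_const (hN.measure_annulus_lt_top hr s).ne)
    (measurableSet_ball.diff measurableSet_ball) fun y hy => ?_
  have : ‖y‖ < s := by simpa using hy.1
  gcongr

lemma tendsto_measureReal_compl_ball (hN : IsLevyMeasure N) :
    Tendsto (fun r => N.real (Metric.ball 0 r)ᶜ) atTop (𝓝 0) := by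
  have h := tendsto_measure_iInter_atTop (μ := N)
    (s := fun r : ℝ => (Metric.ball (0 : EuclideanSpace ℝ (Fin d)) r)ᶜ)
    (fun r => measurableSet_ball.compl.nullMeasurableSet)
    (fun r s hrs => compl_subset_compl.2 (Metric.ball_subset_ball hrs))
    ⟨1, (hN.measure_compl_ball_lt_top one_pos).ne⟩
  have e : ⋂ r : ℝ, (Metric.ball (0 : EuclideanSpace ℝ (Fin d)) r)ᶜ = ∅ := by
    ext y
    simp only [mem_iInter, mem_compl_iff, mem_ball_zero_iff, not_lt, mem_empty_iff_false,
      iff_false, not_forall, not_le]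
    exact ⟨_, lt_add_one _⟩
  rw [e, measure_empty] at h
  exact (ENNReal.tendsto_toReal ENNReal.zero_ne_top).comp h

lemma tendsto_secondMoment (hN : IsLevyMeasure N) :
    Tendsto (secondMoment N) (𝓝[>] 0) (𝓝 0) := by
  have h : Tendsto (fun r : ℝ => ∫ y, (Metric.ball (0 : EuclideanSpace ℝ (Fin d)) r).indicator
      (fun y => ‖y‖ ^ 2) y ∂N) (𝓝[>] 0) (𝓝 (∫ _, (0 : ℝ) ∂N)) := by
    refine tendsto_integral_filter_of_dominated_convergence
      ((Metric.ball (0 : EuclideanSpace ℝ (Fin d)) 1).indicator (fun y => ‖y‖ ^ 2)) ?_ ?_ ?_ ?_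
    · exact Eventually.of_forall fun r =>
        AEStronglyMeasurable.indicator (by fun_prop) measurableSet_ball
    · filter_upwards [Ioo_mem_nhdsGT one_pos] with r hr
      refine Eventually.of_forall fun y => ?_
      rw [Real.norm_of_nonneg (indicator_nonneg (fun _ _ => by positivity) _)]
      exact indicator_le_indicator_of_subset (Metric.ball_subset_ball hr.2.le)
        (fun _ => by positivity) y
    · exact (hN.integrableOn_norm_sq 1).integrable_indicator measurableSet_ball
    · refine Eventually.of_forall fun y => ?_
      rcases eq_or_ne y 0 with rfl | hy
      · exact tendsto_const_nhds.congr fun r => by simp [indicator]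
      · refine tendsto_const_nhds.congr' ?_
        filter_upwards [Ioo_mem_nhdsGT (norm_pos_iff.2 hy)] with r hr
        rw [indicator_of_notMem]
        simpa using hr.2.le
  rw [integral_zero] at h
  refine h.congr fun r => ?_
  rw [integral_indicator measurableSet_ball]
  rfl

/-- Upper bound for the jump part of the characteristic exponent. -/
lemma integral_one_sub_cos_le (hN : IsLevyMeasure N) {r : ℝ} (hr : 0 < r)
    (z : EuclideanSpace ℝ (Fin d)) :
    ∫ y, (1 - Real.cos (inner ℝ y z)) ∂N ≤
      ‖z‖ ^ 2 * secondMoment N r + 2 * N.real (Metric.ball 0 r)ᶜ := by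
  have hi := hN.integrable_one_sub_cos z
  rw [← integral_add_compl (measurableSet_ball (x := 0) (ε := r)) hi]
  gcongr
  · rw [secondMoment, ← integral_const_mul]
    refine integral_mono hi.integrableOn ((hN.integrableOn_norm_sq r).const_mul _) fun y => ?_
    have h1 := Real.one_sub_sq_div_two_le_cos (x := inner ℝ y z)
    have h2 : |(inner ℝ y z : ℝ)| ^ 2 ≤ (‖y‖ * ‖z‖) ^ 2 := by
      gcongr
      exact abs_real_inner_le_norm y z
    rw [sq_abs, mul_pow] at h2
    have h3 := sq_nonneg (inner ℝ y z : ℝ)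
    dsimp only
    linarith
  · rw [mul_comm, ← smul_eq_mul, ← setIntegral_const]
    refine integral_mono hi.integrableOn
      (integrableOn_const (hN.measure_compl_ball_lt_top hr).ne) fun y => ?_
    have := Real.neg_one_le_cos (inner ℝ y z)
    dsimp only
    linarith

/-- Lower bound for the jump part of the characteristic exponent by the second moments. -/
lemma secondMoment_le_sum (hN : IsLevyMeasure N) {r : ℝ} (hr : 0 < r) :
    2 / Real.pi ^ 2 * (secondMoment N r / r ^ 2) ≤
      ∑ i, ∫ y, (1 - Real.cos (inner ℝ y (r⁻¹ • EuclideanSpace.single i (1 : ℝ)))) ∂N := by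
  rw [← integral_finsetSum _ fun i _ => hN.integrable_one_sub_cos _, secondMoment,
    ← integral_div, ← integral_const_mul]
  have hi : Integrable (fun y : EuclideanSpace ℝ (Fin d) =>
      ∑ i, (1 - Real.cos (inner ℝ y (r⁻¹ • EuclideanSpace.single i (1 : ℝ))))) N :=
    integrable_finsetSum _ fun i _ => hN.integrable_one_sub_cos _
  have h0 : ∀ y : EuclideanSpace ℝ (Fin d),
      0 ≤ ∑ i, (1 - Real.cos (inner ℝ y (r⁻¹ • EuclideanSpace.single i (1 : ℝ)))) := fun y =>
    Finset.sum_nonneg fun i _ => by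
      linarith [Real.cos_le_one (inner ℝ y (r⁻¹ • EuclideanSpace.single i (1 : ℝ)))]
  refine le_trans ?_ (setIntegral_le_integral (s := Metric.ball 0 r) hi
    (Eventually.of_forall h0))
  refine setIntegral_mono_on (((hN.integrableOn_norm_sq r).div_const _).const_mul _)
    hi.integrableOn measurableSet_ball fun y hy => ?_
  have hy' : ‖y‖ < r := by simpa using hy
  rw [EuclideanSpace.norm_sq_eq, Finset.sum_div, Finset.mul_sum]
  refine Finset.sum_le_sum fun i _ => ?_
  have e : (inner ℝ y (r⁻¹ • EuclideanSpace.single i (1 : ℝ)) : ℝ) = y i / r := by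
    rw [inner_smul_right, EuclideanSpace.inner_single_right]
    simp [div_eq_inv_mul]
  have hyi : |y i| ≤ ‖y‖ := by
    simpa using PiLp.norm_apply_le y i
  rw [e]
  -- Inside the ball `|y i / r| ≤ 1 < π`, so the quadratic lower bound for `1 - cos` applies;
  -- summing over `i` restores `‖y‖²`.
  have h1 := Real.cos_le_one_sub_mul_cos_sq (x := y i / r) (by
    rw [abs_div, abs_of_pos hr, div_le_iff₀ hr]
    nlinarith [Real.pi_gt_three])
  rw [Real.norm_eq_abs, sq_abs, ← div_pow]
  linarith

end IsLevyMeasure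

/-! ### Unimodal Lévy measures -/

/-- The measure with density `ν(|z|)`. -/
noncomputable def radialMeasure (d : ℕ) (ν : ℝ → ℝ) : Measure (EuclideanSpace ℝ (Fin d)) :=
  volume.withDensity fun z : EuclideanSpace ℝ (Fin d) => ENNReal.ofReal (ν ‖z‖)

section Radial

variable {d : ℕ} {ν : ℝ → ℝ}

/-- Superlevel sets of a non-increasing function on `(0, ∞)` are intervals. The indicator discards
the unconstrained values of `ν` on `(-∞, 0]`. -/
lemma measurable_indicator_Ioi_of_antitoneOn (h0 : ∀ r, 0 < r → 0 ≤ ν r)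
    (hν : AntitoneOn ν (Ioi 0)) : Measurable ((Ioi 0).indicator ν) := by
  refine measurable_of_Ioi fun c => ?_
  rcases lt_or_ge c 0 with hc | hc
  · convert MeasurableSet.univ
    ext x
    simp only [mem_preimage, mem_Ioi, mem_univ, iff_true]
    exact hc.trans_le (indicator_nonneg h0 x)
  · have : OrdConnected ((Ioi 0).indicator ν ⁻¹' Ioi c) := by
      have hpos : ∀ x, c < (Ioi 0).indicator ν x → 0 < x := fun x hx => by
        by_contra hx0
        rw [indicator_of_notMem (by simpa using hx0)] at hx
        exact hx.not_ge hc
      refine ⟨fun x hx y hy w hw => ?_⟩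
      have hx0 := hpos x hx
      have hy0 := hpos y hy
      have hw0 : 0 < w := hx0.trans_le hw.1
      rw [mem_preimage, indicator_of_mem (mem_Ioi.2 hy0)] at hy
      rw [mem_preimage, indicator_of_mem (mem_Ioi.2 hw0)]
      exact lt_of_lt_of_le hy (hν hw0 hy0 hw.2)
    exact this.measurableSet

lemma ae_norm_pos (hd : 0 < d) : ∀ᵐ z : EuclideanSpace ℝ (Fin d), 0 < ‖z‖ := by
  have : Nonempty (Fin d) := ⟨⟨0, hd⟩⟩
  filter_upwards [compl_mem_ae_iff.2 (measure_singleton (0 : EuclideanSpace ℝ (Fin d)))] with z hz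
  exact norm_pos_iff.2 hz

lemma aemeasurable_radial (hd : 0 < d) (h0 : ∀ r, 0 < r → 0 ≤ ν r)
    (hν : AntitoneOn ν (Ioi 0)) :
    AEMeasurable (fun z : EuclideanSpace ℝ (Fin d) => ν ‖z‖) := by
  refine ⟨_, (measurable_indicator_Ioi_of_antitoneOn h0 hν).comp measurable_norm, ?_⟩
  filter_upwards [ae_norm_pos hd] with z hz
  rw [Function.comp_apply, indicator_of_mem (mem_Ioi.2 hz)]

lemma setIntegral_radialMeasure (hd : 0 < d) (h0 : ∀ r, 0 < r → 0 ≤ ν r)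
    (hν : AntitoneOn ν (Ioi 0)) (g : EuclideanSpace ℝ (Fin d) → ℝ)
    {s : Set (EuclideanSpace ℝ (Fin d))} (hs : MeasurableSet s) :
    ∫ z in s, g z ∂radialMeasure d ν = ∫ z in s, g z * ν ‖z‖ := by
  rw [radialMeasure, setIntegral_withDensity_eq_setIntegral_toReal_smul₀
    (aemeasurable_radial hd h0 hν).ennreal_ofReal.restrict
    (Eventually.of_forall fun _ => ENNReal.ofReal_lt_top) g hs]
  refine integral_congr_ae (ae_restrict_of_ae ?_)
  filter_upwards [ae_norm_pos hd] with z hz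
  rw [ENNReal.toReal_ofReal (h0 _ hz), smul_eq_mul, mul_comm]

lemma pruittK_eq (hd : 0 < d) (h0 : ∀ r, 0 < r → 0 ≤ ν r) (hν : AntitoneOn ν (Ioi 0)) (σ r : ℝ) :
    pruittK d σ ν r =
      (σ ^ 2 * d + IsLevyMeasure.secondMoment (radialMeasure d ν) r) / r ^ 2 := by
  rw [pruittK, ← setIntegral_radialMeasure hd h0 hν _ measurableSet_ball, integral_div, add_div,
    IsLevyMeasure.secondMoment]

lemma pruittL_eq (hd : 0 < d) (h0 : ∀ r, 0 < r → 0 ≤ ν r) (hν : AntitoneOn ν (Ioi 0)) (r : ℝ) :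
    pruittL d ν r = (radialMeasure d ν).real (Metric.ball 0 r)ᶜ := by
  have h := setIntegral_radialMeasure hd h0 hν (fun _ => 1)
    (measurableSet_ball (x := (0 : EuclideanSpace ℝ (Fin d))) (ε := r)).compl
  simp only [one_mul, setIntegral_const, smul_eq_mul, mul_one] at h
  exact h.symm

/-- Translating a set towards the origin increases its mass. -/
lemma radialMeasure_translate_le (hν : AntitoneOn ν (Ioi 0))
    {t : Set (EuclideanSpace ℝ (Fin d))} (ht : MeasurableSet t) (v : EuclideanSpace ℝ (Fin d))
    (htv : ∀ x ∈ t, x ≠ 0 ∧ ‖x‖ ≤ ‖x + v‖) :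
    radialMeasure d ν ((fun y => y - v) ⁻¹' t) ≤ radialMeasure d ν t := by
  have hm : MeasurableSet ((fun y : EuclideanSpace ℝ (Fin d) => y - v) ⁻¹' t) :=
    (measurable_sub_const v) ht
  rw [radialMeasure, withDensity_apply _ hm, withDensity_apply _ ht,
    ← (measurePreserving_sub_right volume v).setLIntegral_comp_preimage_emb
      (MeasurableEquiv.subRight v).measurableEmbedding (fun z => ENNReal.ofReal (ν ‖z‖)) t]
  refine setLIntegral_mono' hm fun y hy => ?_
  obtain ⟨h1, h2⟩ := htv _ hy
  rw [sub_add_cancel] at h2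
  have h3 : 0 < ‖y - v‖ := norm_pos_iff.2 h1
  exact ENNReal.ofReal_le_ofReal (hν h3 (h3.trans_le h2) h2)

/-- Let `f` be the linear form. A point of the half-space outside the right-hand set has `f > π` and
`cos f > cos δ ≥ 0`. Moving it back by half a period lands in `t`, where `f > 0` and `cos f ≤ 0`.
There the density is no smaller, and `t` lies in the right-hand set, which is therefore counted
twice. -/
lemma radialMeasure_halfSpace_le (hν : AntitoneOn ν (Ioi 0)) {e : EuclideanSpace ℝ (Fin d)}
    (he : ‖e‖ = 1) {r δ : ℝ} (hr : 0 < r) (hδ0 : 0 < δ) (hδ : δ ≤ Real.pi / 2) :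
    radialMeasure d ν {y | δ ≤ inner ℝ y (r⁻¹ • e)} ≤
      2 * radialMeasure d ν {y | 1 - Real.cos δ ≤ 1 - Real.cos (inner ℝ y (r⁻¹ • e))} := by
  set f : EuclideanSpace ℝ (Fin d) → ℝ := fun y => inner ℝ y (r⁻¹ • e) with hf
  have hfm : Measurable f := by fun_prop
  set v := (Real.pi * r) • e with hv
  have hfv : ∀ y, f (y - v) = f y - Real.pi := fun y => by
    simp only [hf, hv]
    have hee : (inner ℝ e e : ℝ) = 1 := by rw [real_inner_self_eq_norm_sq, he, one_pow]
    rw [inner_sub_left, real_inner_smul_left, real_inner_smul_right e e, hee]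
    field_simp
  set t := {x | 0 < f x ∧ Real.cos (f x) ≤ 0} with ht
  have htm : MeasurableSet t :=
    (measurableSet_lt measurable_const hfm).inter
      (measurableSet_le (Real.measurable_cos.comp hfm) measurable_const)
  have hcδ : 0 ≤ Real.cos δ := Real.cos_nonneg_of_mem_Icc ⟨by linarith, hδ⟩
  have htr := radialMeasure_translate_le (ν := ν) hν htm v (fun x hx => by
    refine ⟨?_, ?_⟩
    · rintro rfl
      have := hx.1
      simp [hf] at this
    · have h1 : 0 < (inner ℝ x (r⁻¹ • e) : ℝ) := hx.1
      rw [inner_smul_right] at h1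
      have h2 : 0 < (inner ℝ x e : ℝ) := pos_of_mul_pos_right h1 (by positivity)
      refine le_of_sq_le_sq ?_ (norm_nonneg _)
      rw [norm_add_sq_real, hv, inner_smul_right]
      have : 0 < Real.pi * r := by positivity
      nlinarith [mul_pos this h2, sq_nonneg ‖(Real.pi * r) • e‖])
  set q := {y | 1 - Real.cos δ ≤ 1 - Real.cos (f y)} with hq
  have hsub : {y | δ ≤ f y} ⊆ q ∪ (fun y => y - v) ⁻¹' t := by
    intro y hy
    have hy' : δ ≤ f y := hy
    rcases le_or_gt (Real.cos (f y)) (Real.cos δ) with hc | hc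
    · left
      simp only [hq, mem_ofPred_eq]
      linarith
    · right
      have hpi : Real.pi < f y := by
        by_contra hle
        exact hc.not_ge (Real.cos_le_cos_of_nonneg_of_le_pi hδ0.le (not_lt.1 hle) hy')
      simp only [ht, mem_preimage, mem_ofPred_eq, hfv, Real.cos_sub_pi]
      constructor <;> linarith
  have htq : t ⊆ q := fun x hx => by
    have := hx.2
    simp only [hq, mem_ofPred_eq]
    linarith
  calc radialMeasure d ν {y | δ ≤ f y} ≤ radialMeasure d ν q + radialMeasure d ν t :=
        ((measure_mono hsub).trans (measure_union_le _ _)).trans (by gcongr)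
    _ ≤ radialMeasure d ν q + radialMeasure d ν q := by gcongr
    _ = _ := (two_mul _).symm

/-- Markov's inequality for `1 - cos` at level `1 - cos δ`, combined with the translation estimate.
-/
lemma measureReal_halfSpace_le (hN : IsLevyMeasure (radialMeasure d ν))
    (hν : AntitoneOn ν (Ioi 0)) {e : EuclideanSpace ℝ (Fin d)}
    (he : ‖e‖ = 1) {r δ : ℝ} (hr : 0 < r) (hδ0 : 0 < δ) (hδ : δ ≤ Real.pi / 2) :
    (1 - Real.cos δ) * (radialMeasure d ν).real {y | δ ≤ inner ℝ y (r⁻¹ • e)} ≤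
      2 * ∫ y, (1 - Real.cos (inner ℝ y (r⁻¹ • e))) ∂radialMeasure d ν := by
  have hi := hN.integrable_one_sub_cos (r⁻¹ • e)
  have hc : 0 < 1 - Real.cos δ := by
    have := Real.cos_lt_cos_of_nonneg_of_le_pi le_rfl (by linarith [Real.pi_pos]) hδ0
    rw [Real.cos_zero] at this
    linarith
  have h1 := mul_meas_ge_le_integral_of_nonneg
    (Eventually.of_forall fun y => by
      have := Real.cos_le_one (inner ℝ y (r⁻¹ • e))
      simp only [Pi.zero_apply]
      linarith) hi (1 - Real.cos δ)
  have h2 := ENNReal.toReal_mono (ENNReal.mul_ne_top ENNReal.ofNat_ne_top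
    (hi.measure_ge_lt_top hc).ne) (radialMeasure_halfSpace_le (ν := ν) hν he hr hδ0 hδ)
  rw [ENNReal.toReal_mul, ENNReal.toReal_ofNat] at h2
  calc (1 - Real.cos δ) * (radialMeasure d ν).real {y | δ ≤ inner ℝ y (r⁻¹ • e)}
      ≤ (1 - Real.cos δ) * (2 * (radialMeasure d ν).real
        {y | 1 - Real.cos δ ≤ 1 - Real.cos (inner ℝ y (r⁻¹ • e))}) :=
        mul_le_mul_of_nonneg_left h2 hc.le
    _ = 2 * ((1 - Real.cos δ) * (radialMeasure d ν).real
        {y | 1 - Real.cos δ ≤ 1 - Real.cos (inner ℝ y (r⁻¹ • e))}) := by ring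
    _ ≤ _ := mul_le_mul_of_nonneg_left h1 zero_le_two

/-- Lower bound for the jump part of the characteristic exponent by the tail. -/
lemma measureReal_compl_ball_le_sum (hd : 0 < d) (hN : IsLevyMeasure (radialMeasure d ν))
    (hν : AntitoneOn ν (Ioi 0)) {r : ℝ} (hr : 0 < r) :
    (1 - Real.cos (1 / √d)) * (radialMeasure d ν).real (Metric.ball 0 r)ᶜ ≤
      4 * ∑ i, ∫ y, (1 - Real.cos (inner ℝ y (r⁻¹ • EuclideanSpace.single i (1 : ℝ))))
        ∂radialMeasure d ν := by
  have hd1 : (1 : ℝ) ≤ √d := Real.one_le_sqrt.2 (by exact_mod_cast hd)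
  have hdp : 0 < √(d : ℝ) := by linarith
  set δ := 1 / √(d : ℝ) with hδ
  -- A vector of norm at least `r` has a coordinate of modulus at least `r / √d`, so the half-spaces
  -- at level `δ` in the directions `± e i` cover the complement of the ball.
  have hδ0 : 0 < δ := by positivity
  have hδ1 : δ ≤ 1 := (div_le_one hdp).2 hd1
  have hδπ : δ ≤ Real.pi / 2 := by linarith [Real.pi_gt_three]
  set e : Fin d → EuclideanSpace ℝ (Fin d) := fun i => EuclideanSpace.single i (1 : ℝ) with he
  have hen : ∀ i, ‖e i‖ = 1 := fun i => by simp [he]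
  have hc : 0 ≤ 1 - Real.cos δ := by linarith [Real.cos_le_one δ]
  have hin : ∀ y i, (inner ℝ y (r⁻¹ • e i) : ℝ) = y i / r := fun y i => by
    rw [inner_smul_right, EuclideanSpace.inner_single_right]
    simp [div_eq_inv_mul]
  set A : Fin d → Set (EuclideanSpace ℝ (Fin d)) := fun i =>
    {y | δ ≤ inner ℝ y (r⁻¹ • e i)} ∪ {y | δ ≤ inner ℝ y (r⁻¹ • -e i)} with hA
  -- Each `A i` avoids the ball of radius `δ * r`. Finiteness is essential because `Measure.real`
  -- sends infinite mass to zero.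
  have hfin : ∀ i, radialMeasure d ν (A i) ≠ ∞ := fun i => by
    refine ((measure_mono fun y hy => ?_).trans_lt
      (hN.measure_compl_ball_lt_top (r := δ * r) (by positivity))).ne
    have h1 : δ ≤ |y i / r| := by
      rcases hy with hy | hy
      · exact (le_trans hy (hin y i).le).trans (le_abs_self _)
      · have hy' : δ ≤ inner ℝ y (r⁻¹ • -e i) := hy
        rw [smul_neg, inner_neg_right, hin] at hy'
        exact hy'.trans (neg_le_abs _)
    rw [abs_div, abs_of_pos hr, le_div_iff₀ hr] at h1
    have h2 : |y i| ≤ ‖y‖ := by simpa using PiLp.norm_apply_le y i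
    simpa using h1.trans h2
  have hsub : (Metric.ball (0 : EuclideanSpace ℝ (Fin d)) r)ᶜ ⊆ ⋃ i, A i := by
    intro y hy
    have hy' : r ≤ ‖y‖ := by simpa using hy
    by_contra hno
    simp only [hA, mem_iUnion, mem_union, mem_ofPred_eq, smul_neg, inner_neg_right, hin, not_exists,
      not_or, not_le] at hno
    have h1 : ∀ i, ‖y i‖ ^ 2 < r ^ 2 / d := fun i => by
      have h2 : |y i / r| < δ := abs_lt.2 ⟨by linarith [(hno i).2], (hno i).1⟩
      have h3 : |y i / r| ^ 2 < δ ^ 2 := by gcongr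
      rw [sq_abs, div_pow, div_lt_iff₀ (by positivity), hδ, div_pow,
        Real.sq_sqrt (by positivity)] at h3
      rw [Real.norm_eq_abs, sq_abs]
      calc _ < _ := h3
        _ = _ := by ring
    have : Nonempty (Fin d) := ⟨⟨0, hd⟩⟩
    have h4 : ‖y‖ ^ 2 < ∑ _i : Fin d, r ^ 2 / d := by
      rw [EuclideanSpace.norm_sq_eq]
      exact Finset.sum_lt_sum_of_nonempty Finset.univ_nonempty fun i _ => h1 i
    have hd0 : (d : ℝ) ≠ 0 := by exact_mod_cast hd.ne'
    rw [Finset.sum_const, Finset.card_univ, Fintype.card_fin, nsmul_eq_mul,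
      mul_div_cancel₀ _ hd0] at h4
    exact h4.not_ge (by gcongr)
  have h1 : (radialMeasure d ν).real (Metric.ball 0 r)ᶜ ≤ ∑ i, (radialMeasure d ν).real (A i) :=
    (measureReal_mono hsub (by
      exact ((measure_iUnion_fintype_le _ _).trans_lt
        (ENNReal.sum_lt_top.2 fun i _ => (hfin i).lt_top)).ne)).trans
      (measureReal_iUnion_fintype_le _)
  refine (mul_le_mul_of_nonneg_left h1 hc).trans ?_
  rw [Finset.mul_sum, Finset.mul_sum]
  refine Finset.sum_le_sum fun i _ => ?_
  -- Each of the two opposite half-spaces costs a factor 2, and cosine is even; this gives the 4.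
  have h2 := measureReal_halfSpace_le hN hν (hen i) hr hδ0 hδπ
  have h3 := measureReal_halfSpace_le hN hν (e := -e i) (by rw [norm_neg, hen]) hr hδ0 hδπ
  have h4 : ∀ y, Real.cos (inner ℝ y (r⁻¹ • -e i)) = Real.cos (inner ℝ y (r⁻¹ • e i)) := fun y => by
    rw [smul_neg, inner_neg_right, Real.cos_neg]
  simp only [h4] at h3
  have h5 := mul_le_mul_of_nonneg_left (measureReal_union_le (μ := radialMeasure d ν)
    {y | δ ≤ inner ℝ y (r⁻¹ • e i)} {y | δ ≤ inner ℝ y (r⁻¹ • -e i)}) hc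
  linarith

/-- A nontrivial non-increasing radial density charges every ball. -/
lemma radialMeasure_eq_zero_of_ball (hd : 0 < d) (h0 : ∀ r, 0 < r → 0 ≤ ν r)
    (hν : AntitoneOn ν (Ioi 0)) {r : ℝ} (hr : 0 < r)
    (hb : radialMeasure d ν (Metric.ball 0 r) = 0) : radialMeasure d ν = 0 := by
  have hz : ∀ s, 0 < s → ν s = 0 := by
    by_contra! hne
    obtain ⟨s, hs, hνs⟩ := hne
    have hνs' : 0 < ν s := (h0 s hs).lt_of_ne' hνs
    set m := min s r with hm
    have hm0 : 0 < m := lt_min hs hr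
    have h1 : ENNReal.ofReal (ν s) * volume (Metric.ball (0 : EuclideanSpace ℝ (Fin d)) m) ≤
        radialMeasure d ν (Metric.ball 0 m) := by
      rw [radialMeasure, withDensity_apply _ measurableSet_ball, ← setLIntegral_const]
      refine lintegral_mono_ae ?_
      filter_upwards [ae_restrict_mem measurableSet_ball, ae_restrict_of_ae (ae_norm_pos hd)]
        with y hy hy0
      have : ‖y‖ < m := by simpa using hy
      exact ENNReal.ofReal_le_ofReal (hν hy0 hs (this.le.trans (min_le_left _ _)))
    have h2 : 0 < ENNReal.ofReal (ν s) * volume (Metric.ball (0 : EuclideanSpace ℝ (Fin d)) m) :=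
      ENNReal.mul_pos (by simpa using hνs') (Metric.measure_ball_pos _ _ hm0).ne'
    have h3 := (h2.trans_le h1).trans_le
      (measure_mono (Metric.ball_subset_ball (min_le_right s r)))
    exact h3.ne' hb
  rw [radialMeasure, withDensity_eq_zero_iff]
  · filter_upwards [ae_norm_pos hd] with z hz0
    simp [hz _ hz0]
  · exact (aemeasurable_radial hd h0 hν).ennreal_ofReal

end Radial

/-! ### Isotropic unimodal Lévy processes -/

namespace IsIsotropicUnimodalLevyProcess

open IsLevyMeasure

variable {d : ℕ} {Ω : Type*} [MeasurableSpace Ω] {P : Measure Ω}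
  {X : ℝ≥0 → Ω → EuclideanSpace ℝ (Fin d)} {σ : ℝ} {ν Ψ : ℝ → ℝ}

lemma isLevyMeasure (hX : IsIsotropicUnimodalLevyProcess X P σ ν) :
    IsLevyMeasure (radialMeasure d ν) :=
  hX.triplet.2.1

/-- Comparing moduli of the two formulas at `t = 1` identifies real parts directly, without choosing
a branch of the logarithm. -/
lemma charExponent_eq (hX : IsIsotropicUnimodalLevyProcess X P σ ν)
    (hΨ : IsCharExponentProfile X P Ψ) (z : EuclideanSpace ℝ (Fin d)) :
    Ψ ‖z‖ = σ ^ 2 * ‖z‖ ^ 2 + ∫ y, (1 - Real.cos (inner ℝ y z)) ∂radialMeasure d ν := by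
  have h := (hX.triplet.2.2 1 z).symm.trans (hΨ 1 z)
  have h1 := congrArg norm h
  rw [Complex.norm_exp, Complex.norm_exp, Complex.ofReal_re] at h1
  have h2 := Real.exp_injective h1
  simp only [NNReal.coe_one, Complex.ofReal_one, neg_mul, one_mul, Complex.neg_re,
    neg_inj] at h2
  rw [← hX.isLevyMeasure.re_levyKhintchineExponent]
  exact h2.symm

/-- If the sum vanished, there would be no Gaussian part and no jumps in the ball, hence by
monotonicity of `ν` no jumps at all. Every `X t` would then be zero almost surely, contrary to
non-constancy. -/
lemma gaussian_add_secondMoment_pos [IsProbabilityMeasure P] (hd : 0 < d)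
    (hX : IsIsotropicUnimodalLevyProcess X P σ ν) (hΨ : IsCharExponentProfile X P Ψ)
    {r : ℝ} (hr : 0 < r) : 0 < σ ^ 2 * d + secondMoment (radialMeasure d ν) r := by
  have h1 := secondMoment_nonneg (radialMeasure d ν) r
  have hdR : (0 : ℝ) < d := by exact_mod_cast hd
  have h2 : 0 ≤ σ ^ 2 * d := by positivity
  refine (add_nonneg h2 h1).lt_of_ne' fun h3 => hX.nonconstant ?_
  have hσ : σ ^ 2 = 0 := by
    have : σ ^ 2 * d = 0 := by linarith
    exact (mul_eq_zero.1 this).resolve_right hdR.ne'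
  have hm : secondMoment (radialMeasure d ν) r = 0 := by linarith
  have hball : radialMeasure d ν (Metric.ball 0 r) = 0 := by
    rw [secondMoment, integral_eq_zero_iff_of_nonneg (fun y => by positivity)
      (hX.isLevyMeasure.integrableOn_norm_sq r)] at hm
    rw [← Measure.restrict_eq_zero, ← Measure.measure_univ_eq_zero,
      Measure.restrict_apply_univ]
    refine measure_mono_null (fun y hy => ?_)
      (measure_union_null hX.isLevyMeasure.1 ((ae_restrict_iff' measurableSet_ball).1 hm))
    by_cases hy0 : y = 0
    · exact Or.inl hy0
    · right
      intro hc
      exact hy0 (by simpa using hc hy)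
  have hN := radialMeasure_eq_zero_of_ball hd hX.profile_nonneg hX.profile_antitone hr hball
  have hchar : ∀ z : EuclideanSpace ℝ (Fin d), Ψ ‖z‖ = 0 := fun z => by
    rw [hX.charExponent_eq hΨ, hσ, hN]
    simp
  intro t
  have hmt := hX.isLevy.measurable t
  have : IsProbabilityMeasure (P.map (X t)) := Measure.isProbabilityMeasure_map hmt.aemeasurable
  have hmap : P.map (X t) = Measure.dirac 0 := by
    refine Measure.ext_of_charFun (funext fun z => ?_)
    rw [hΨ t z, hchar, charFun_dirac]
    simp
  have hae : ∀ᵐ x ∂P.map (X t), x = 0 := by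
    rw [hmap, ae_dirac_eq]
    rfl
  filter_upwards [ae_of_ae_map hmt.aemeasurable hae, hX.isLevy.zero] with ω h1 h2
  rw [h1, h2]

lemma isPruittPair [IsProbabilityMeasure P] (hd : 0 < d)
    (hX : IsIsotropicUnimodalLevyProcess X P σ ν) (hΨ : IsCharExponentProfile X P Ψ) :
    IsPruittPair (pruittK d σ ν) (pruittL d ν) (σ ^ 2 * d) := by
  have hN := hX.isLevyMeasure
  have eK := fun r => pruittK_eq hd hX.profile_nonneg hX.profile_antitone σ r
  have eL : pruittL d ν = fun r => (radialMeasure d ν).real (Metric.ball 0 r)ᶜ :=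
    funext fun r => pruittL_eq hd hX.profile_nonneg hX.profile_antitone r
  have eK' : ∀ r, 0 < r →
      r ^ 2 * pruittK d σ ν r = σ ^ 2 * d + secondMoment (radialMeasure d ν) r := fun r hr => by
    rw [eK]; field_simp
  constructor
  · intro r hr
    rw [eK]
    exact div_pos (hX.gaussian_add_secondMoment_pos hd hΨ hr) (by positivity)
  · intro r _
    rw [eL]
    exact measureReal_nonneg
  · intro r s hr hrs
    rw [eL]
    exact measureReal_mono (compl_subset_compl.2 (Metric.ball_subset_ball hrs))
      (hN.measure_compl_ball_lt_top hr).ne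
  · intro r s hr hrs
    rw [eK' r hr, eK' s (hr.trans_le hrs), add_sub_add_left_eq_sub, eL]
    exact hN.le_secondMoment_sub hr hrs
  · intro r s hr hrs
    rw [eK' r hr, eK' s (hr.trans_le hrs), add_sub_add_left_eq_sub, eL]
    exact hN.secondMoment_sub_le hr hrs
  · rw [eL]
    exact hN.tendsto_measureReal_compl_ball
  · have h := hN.tendsto_secondMoment.const_add (σ ^ 2 * d)
    rw [add_zero] at h
    refine h.congr' ?_
    filter_upwards [self_mem_nhdsWithin] with r hr
    exact (eK' r hr).symm

/-- The arithmetic of the comparison, with `n = d`, `s = σ² / r²`, `M` the second moment over `r²`,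
`T` the tail, `S` the sum of the jump integrals over coordinates and `F = Ψ(1/r)`. -/
lemma two_sided_bound {n p q s M T S F : ℝ} (hn : 1 ≤ n) (hp : 1 ≤ p) (hq : 0 ≤ q)
    (hs : 0 ≤ s) (hM : 0 ≤ M) (hT : 0 ≤ T) (hS : 0 ≤ S) (hF : n * F = n * s + S)
    (hMS : M ≤ p * S) (hTS : T ≤ q * S) (hup : F ≤ s + M + 2 * T) :
    (p * n + q * n + 2)⁻¹ * (n * s + M + T) ≤ F ∧ F ≤ (p * n + q * n + 2) * (n * s + M + T) := by
  have hns : s ≤ n * s := le_mul_of_one_le_left hs hn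
  constructor
  · have hF0 : 0 ≤ F := by
      have : 0 ≤ n * F := by rw [hF]; positivity
      exact nonneg_of_mul_nonneg_right this (by linarith)
    rw [inv_mul_le_iff₀ (by positivity)]
    have h1 : (p * n + q * n + 2) * F = (p + q) * (n * F) + 2 * F := by ring
    have h2 : n * s ≤ p * (n * s) := le_mul_of_one_le_left (by positivity) hp
    have h3 : 0 ≤ q * (n * s) := by positivity
    rw [h1, hF]
    linarith
  · have h1 : 0 ≤ (p * n + q * n) * (n * s + M + T) := by positivity
    linarith

/-- The characteristic exponent at `1 / r` is comparable with `K(r) + L(r)`. -/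
lemma comparableOn_charExponent (hd : 0 < d)
    (hX : IsIsotropicUnimodalLevyProcess X P σ ν) (hΨ : IsCharExponentProfile X P Ψ) :
    ComparableOn (Ioi 0) (fun r => Ψ (1 / r)) (fun r => pruittK d σ ν r + pruittL d ν r) := by
  have hN := hX.isLevyMeasure
  have hdR : (1 : ℝ) ≤ d := by exact_mod_cast hd
  set δ := 1 / √(d : ℝ) with hδ
  have hδ0 : 0 < δ := by positivity
  have hδ1 : δ ≤ 1 := (div_le_one (by positivity)).2 (Real.one_le_sqrt.2 hdR)
  set c := 1 - Real.cos δ with hc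
  have hc0 : 0 < c := by
    have := Real.cos_lt_cos_of_nonneg_of_le_pi le_rfl (by linarith [Real.pi_gt_three]) hδ0
    rw [Real.cos_zero] at this
    linarith
  refine ⟨Real.pi ^ 2 / 2 * d + 4 / c * d + 2, by positivity, fun r hr => ?_⟩
  have hr0 : 0 < r := hr
  set M := secondMoment (radialMeasure d ν) r with hM
  have hM0 : 0 ≤ M := secondMoment_nonneg _ r
  set T := (radialMeasure d ν).real (Metric.ball 0 r)ᶜ with hT
  have hT0 : 0 ≤ T := measureReal_nonneg
  have eK : pruittK d σ ν r = σ ^ 2 * d / r ^ 2 + M / r ^ 2 := by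
    rw [pruittK_eq hd hX.profile_nonneg hX.profile_antitone, add_div]
  have eL : pruittL d ν r = T := pruittL_eq hd hX.profile_nonneg hX.profile_antitone r
  -- Isotropy: every coordinate direction gives the same value, so summing over `i` produces `d * Ψ
  -- (1 / r)`.
  have eΨ : ∀ i : Fin d, Ψ (1 / r) = σ ^ 2 / r ^ 2 + ∫ y, (1 - Real.cos
      (inner ℝ y (r⁻¹ • EuclideanSpace.single i (1 : ℝ)))) ∂radialMeasure d ν := fun i => by
    have h := hX.charExponent_eq hΨ (r⁻¹ • EuclideanSpace.single i (1 : ℝ))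
    have e : ‖r⁻¹ • EuclideanSpace.single i (1 : ℝ)‖ = 1 / r := by
      rw [norm_smul, PiLp.norm_single, norm_one, mul_one, Real.norm_of_nonneg (by positivity),
        one_div]
    rw [e] at h
    rw [h]
    ring
  set S := ∑ i : Fin d, ∫ y, (1 - Real.cos
      (inner ℝ y (r⁻¹ • EuclideanSpace.single i (1 : ℝ)))) ∂radialMeasure d ν with hS
  have esum : d * Ψ (1 / r) = d * (σ ^ 2 / r ^ 2) + S := by
    have : ∑ _i : Fin d, Ψ (1 / r) = ∑ i : Fin d, (σ ^ 2 / r ^ 2 + ∫ y, (1 - Real.cos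
      (inner ℝ y (r⁻¹ • EuclideanSpace.single i (1 : ℝ)))) ∂radialMeasure d ν) :=
      Finset.sum_congr rfl fun i _ => eΨ i
    simpa [Finset.sum_add_distrib] using this
  have hσ0 : 0 ≤ σ ^ 2 / r ^ 2 := by positivity
  have hMr : 0 ≤ M / r ^ 2 := by positivity
  have hS1 : M / r ^ 2 ≤ Real.pi ^ 2 / 2 * S := by
    have h := hN.secondMoment_le_sum hr0
    calc M / r ^ 2 = Real.pi ^ 2 / 2 * (2 / Real.pi ^ 2 * (M / r ^ 2)) := by
          field_simp
      _ ≤ _ := mul_le_mul_of_nonneg_left h (by positivity)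
  have hS2 : T ≤ 4 / c * S := by
    have h := measureReal_compl_ball_le_sum hd hN hX.profile_antitone hr0
    rw [div_mul_eq_mul_div, le_div_iff₀ hc0, mul_comm]
    exact h
  have hS0 : 0 ≤ S := nonneg_of_mul_nonneg_right (hMr.trans hS1) (by positivity)
  have hdσ : σ ^ 2 * d / r ^ 2 = d * (σ ^ 2 / r ^ 2) := by ring
  have hup : Ψ (1 / r) ≤ σ ^ 2 / r ^ 2 + M / r ^ 2 + 2 * T := by
    rw [eΨ ⟨0, hd⟩, add_assoc]
    gcongr
    refine (hN.integral_one_sub_cos_le hr0 _).trans_eq ?_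
    rw [norm_smul, PiLp.norm_single, norm_one, mul_one, Real.norm_of_nonneg (by positivity)]
    ring
  beta_reduce
  rw [eK, eL, hdσ]
  exact two_sided_bound hdR (by nlinarith [Real.pi_gt_three]) (by positivity) hσ0 hMr hT0 hS0 esum
    hS1 hS2 hup

end IsIsotropicUnimodalLevyProcess

end UnimodalLevy

/-! ### The four equivalences and comparisons. -/

theorem propositionA3 {d : ℕ} (hd : 0 < d) {Ω : Type*} [MeasurableSpace Ω]
    (P : Measure Ω) [IsProbabilityMeasure P]
    (X : ℝ≥0 → Ω → EuclideanSpace ℝ (Fin d)) (σ : ℝ) (ν Ψ : ℝ → ℝ)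
    (hX : UnimodalLevy.IsIsotropicUnimodalLevyProcess X P σ ν)
    (hΨ : UnimodalLevy.IsCharExponentProfile X P Ψ) :
    let K : ℝ → ℝ := UnimodalLevy.pruittK d σ ν
    let L : ℝ → ℝ := UnimodalLevy.pruittL d ν
    -- (a)
    (∀ β : ℝ, 0 ≤ β → β < 2 →
      (UnimodalLevy.HasUpperIndexAtZero Ψ β ↔ UnimodalLevy.HasLowerIndexAtInfinity L (-β)) ∧
      (UnimodalLevy.HasUpperIndexAtZero Ψ β →
        UnimodalLevy.ComparableOn (Ioi 1) L (fun r => K r + L r) ∧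
        UnimodalLevy.ComparableOn (Ioi 1) (fun r => Ψ (1 / r)) (fun r => K r + L r))) ∧
    -- (b)
    (∀ α : ℝ, 0 < α → α ≤ 2 →
      (UnimodalLevy.HasLowerIndexAtZero Ψ α ↔ UnimodalLevy.HasUpperIndexAtInfinity K (-α)) ∧
      (UnimodalLevy.HasLowerIndexAtZero Ψ α →
        UnimodalLevy.ComparableOn (Ioi 1) K (fun r => K r + L r) ∧
        UnimodalLevy.ComparableOn (Ioi 1) (fun r => Ψ (1 / r)) (fun r => K r + L r))) ∧
    -- (c)
    (∀ β : ℝ, 0 ≤ β → β < 2 →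
      (UnimodalLevy.HasUpperIndexAtInfinity Ψ β ↔
        σ ^ 2 = 0 ∧ UnimodalLevy.HasLowerIndexAtZero L (-β)) ∧
      (UnimodalLevy.HasUpperIndexAtInfinity Ψ β →
        (∃ R : ℝ, 0 < R ∧ 0 < L R) ∧
        ∀ R : ℝ, 0 < R → 0 < L R →
          UnimodalLevy.ComparableOn (Ioo 0 R) L (fun r => K r + L r) ∧
          UnimodalLevy.ComparableOn (Ioo 0 R) (fun r => Ψ (1 / r)) (fun r => K r + L r))) ∧
    -- (d)
    (∀ α : ℝ, 0 < α → α ≤ 2 →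
      (UnimodalLevy.HasLowerIndexAtInfinity Ψ α ↔ UnimodalLevy.HasUpperIndexAtZero K (-α)) ∧
      (UnimodalLevy.HasLowerIndexAtInfinity Ψ α →
        UnimodalLevy.ComparableOn (Ioo 0 1) K (fun r => K r + L r) ∧
        UnimodalLevy.ComparableOn (Ioo 0 1) (fun r => Ψ (1 / r)) (fun r => K r + L r))) := by
  intro K L
  have hp : UnimodalLevy.IsPruittPair K L (σ ^ 2 * d) := hX.isPruittPair hd hΨ
  have hcmp : UnimodalLevy.ComparableOn (Ioi 0) (fun r => Ψ (1 / r)) (fun r => K r + L r) :=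
    hX.comparableOn_charExponent hd hΨ
  have hIoi : UnimodalLevy.ComparableOn (Ioi 1) (fun r => Ψ (1 / r)) (fun r => K r + L r) :=
    hcmp.mono (Ioi_subset_Ioi zero_le_one)
  have hIoo : ∀ R : ℝ, UnimodalLevy.ComparableOn (Ioo 0 R) (fun r => Ψ (1 / r))
      (fun r => K r + L r) := fun R => hcmp.mono fun r hr => hr.1
  refine ⟨fun β _ hβ => ?_, fun α hα _ => ?_, fun β _ hβ => ?_, fun α hα _ => ?_⟩
  · have e : UnimodalLevy.HasUpperIndexAtZero Ψ β ↔
        UnimodalLevy.HasLowerIndexAtInfinity (fun r => K r + L r) (-β) := by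
      rw [UnimodalLevy.hasUpperIndexAtZero_iff_comp_inv]
      exact ⟨fun h => h.of_comparableOn hIoi, fun h => h.of_comparableOn hIoi.symm⟩
    have hβ' : -2 < -β := by linarith
    rw [e]
    exact ⟨hp.hasLowerIndexAtInfinity_add_iff hβ', fun h =>
      ⟨hp.comparableOn_L_of_lowerIndexAtInfinity hβ' h one_pos, hIoi⟩⟩
  · have e : UnimodalLevy.HasLowerIndexAtZero Ψ α ↔
        UnimodalLevy.HasUpperIndexAtInfinity (fun r => K r + L r) (-α) := by
      rw [UnimodalLevy.hasLowerIndexAtZero_iff_comp_inv]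
      exact ⟨fun h => h.of_comparableOn hIoi, fun h => h.of_comparableOn hIoi.symm⟩
    have hα' : -α < 0 := by linarith
    rw [e]
    exact ⟨hp.hasUpperIndexAtInfinity_add_iff hα', fun h =>
      ⟨hp.comparableOn_K_of_upperIndexAtInfinity hα' h one_pos, hIoi⟩⟩
  · have e : UnimodalLevy.HasUpperIndexAtInfinity Ψ β ↔
        UnimodalLevy.HasLowerIndexAtZero (fun r => K r + L r) (-β) := by
      rw [UnimodalLevy.hasUpperIndexAtInfinity_iff_comp_inv]
      exact ⟨fun h => h.of_comparableOn one_pos (hIoo 1),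
        fun h => h.of_comparableOn one_pos (hIoo 1).symm⟩
    have hβ' : -2 < -β := by linarith
    have hdR : (0 : ℝ) < d := by exact_mod_cast hd
    rw [e]
    constructor
    · rw [hp.hasLowerIndexAtZero_add_iff (by positivity) hβ', mul_eq_zero, or_iff_left hdR.ne']
    · intro h
      -- Domination of `K + L > 0` by `L` near zero makes `L` positive there. It may vanish at large
      -- radii, so the comparison reaches only up to a radius with `L S > 0`.
      obtain ⟨-, R, C, hR, hC⟩ := hp.nonpos_and_exists_add_le_L hβ' h
      refine ⟨⟨R / 2, by positivity, ?_⟩, fun S _ hLS =>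
        ⟨hp.comparableOn_L_Ioo hR hC hLS, hIoo S⟩⟩
      have hR2 : 0 < R / 2 := by positivity
      have h1 := (hp.add_pos hR2).trans_le (hC (R / 2) ⟨hR2, by linarith⟩)
      exact (hp.L_nonneg _ hR2).lt_of_ne' fun h0 => by simp [h0] at h1
  · have e : UnimodalLevy.HasLowerIndexAtInfinity Ψ α ↔
        UnimodalLevy.HasUpperIndexAtZero (fun r => K r + L r) (-α) := by
      rw [UnimodalLevy.hasLowerIndexAtInfinity_iff_comp_inv]
      exact ⟨fun h => h.of_comparableOn one_pos (hIoo 1),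
        fun h => h.of_comparableOn one_pos (hIoo 1).symm⟩
    have hα' : -α < 0 := by linarith
    rw [e]
    exact ⟨hp.hasUpperIndexAtZero_add_iff hα', fun h =>
      ⟨hp.comparableOn_K_of_upperIndexAtZero hα' h, hIoo 1⟩⟩
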